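/- **Definitions.** A *Peano continuum* is a separable, compact, connected, locally connected metrizable space. An *E-graph* (graph with ends) is a Hausdorff space decomposed into $0$-cells (vertices) and open $1$-cells (edges), such that the decomposition is locally finite and the closure of each edge consists of the edge and of vertices and is homeomorphic to $[-1,1]$ or to $\{t\in\mathbb R\mid t\ge 0\}$. An isomorphism of E-graphs is a homeomorphism that maps vertices to vertices and edges to edges. For a continuous function $c:X\to\mathbb R$, the connected components of the level sets of $c$ are called contours; the *Reeb space* $R_c$ is the quotient space of $X$ obtained by collapsing each contour to a point, and $q_c:X\to R_c$ is the quotient map. If $X$ is a smooth manifold and $c$ is smooth, a contour is *critical* if it contains a critical point of $c$. Let $c_0:\mathbb R\to\mathbb R$ be defined by $c_0(x)=e^{-1/x^2}\,x\sin^2(1/x)$ for $x\ne0$ and $c_0(0)=0$. **Theorem.** There are real numbers $p_1,p_2,r_1,r_2,r_{1,2}>0$ and a Peano continuum $G_2$ with the following properties. 1. $G_2$ is not homeomorphic to any E-graph. There is exactly one point $p\in G_2$ such that $G_2-\{p\}$ is homeomorphic to an E-graph. The space $G_2-\{p\}$ is non-compact, $G_2$ is its one-point compactification with $p$ as the point at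 infinity, and $G_2-\{p\}$ carries a structure of an E-graph, fixed from now on, for which 2 holds. 2. Let $m_1,m_2>1$ be integers, $m=m_1+m_2$, and write the points of $\mathbb R^{m+2}$ as $(x_1,x_2,y,z)$ with $y\in\mathbb R^{m_1}$, $z\in\mathbb R^{m_2}$. Let $e_{m_1,m_2}:\mathbb R^{m+2}\to\mathbb R^2$ be the map $$e_{m_1,m_2}(x_1,x_2,y,z)=\Bigl(x_1-c_0(x_2)-\sum_{j=1}^{m_1}y_j^2,\; r_{1,2}-\frac{(x_1-p_1)^2}{r_1}-\frac{(x_2-p_2)^2}{r_2}-\sum_{j=1}^{m_2}z_j^2\Bigr).$$ Then $e_{m_1,m_2}$ is smooth, and real analytic outside some set of Lebesgue measure $0$. Its zero set $X=e_{m_1,m_2}^{-1}(0)$ is a compact, connected smooth submanifold of $\mathbb R^{m+2}$ of dimension $m$ that contains the origin $0$. Let $c:X\to\mathbb R$ be the restriction of the projection $(x_1,x_2,y,z)\mapsto x_1$. Then there is a homeomorphism $R_c\to G_2$; the space $q_c(X-\{0\})\subset R_c$ has the structure of an E-graph whose vertices are exactly the points representing the contours that contain a critical point of $c$ in $X-\{0\}$;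 and the homeomorphism can be chosen so that it restricts to an isomorphism of this E-graph onto the E-graph $G_2-\{p\}$. -/

import Mathlib

open Set Topology MeasureTheory
open scoped ContDiff

noncomputable section

/-- A Peano continuum: a separable, compact, connected and locally connected metrizable space. -/
structure IsPeanoContinuum (Y : Type*) [TopologicalSpace Y] : Prop where
  separable : TopologicalSpace.SeparableSpace Y
  compact : CompactSpace Y
  connected : ConnectedSpace Y
  locallyConnected : LocallyConnectedSpace Y
  metrizable : TopologicalSpace.MetrizableSpace Y

/-- The structure of an E-graph ("graph with ends") on a topological space `Y`: a locally finite
decomposition of the Hausdorff space `Y` into `0`-cells (vertices) and open `1`-cells (edges), such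
that the closure of each edge is homeomorphic to the closed interval `[-1, 1]` or to the half-line
`{t | 0 ≤ t}`, and is obtained from the edge by adding vertices only.

When all closures are closed intervals, this is a locally finite CW complex of dimension at most
`1` without loops (local finiteness gives the weak topology). A closed half-line is not the closure
of a cell of a CW complex in the strict sense, hence the notion is spelled out by cells. -/
structure EGraph (Y : Type*) [TopologicalSpace Y] where
  /-- the set of vertices -/
  vertices : Set Y
  /-- the set of (open) edges -/
  edges : Set (Set Y)
  t2 : T2Space Y
  disjoint_vertices : ∀ e ∈ edges, Disjoint e vertices
  disjoint_edges : edges.PairwiseDisjoint id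
  cover : vertices ∪ ⋃₀ edges = univ
  edge_homeo : ∀ e ∈ edges, Nonempty (e ≃ₜ ℝ)
  closure_diff_subset : ∀ e ∈ edges, closure e \ e ⊆ vertices
  closure_homeo : ∀ e ∈ edges,
    Nonempty (closure e ≃ₜ Icc (-1 : ℝ) 1) ∨ Nonempty (closure e ≃ₜ Ici (0 : ℝ))
  locally_finite : ∀ y : Y, ∃ U ∈ 𝓝 y,
    (vertices ∩ U).Finite ∧ {e ∈ edges | (closure e ∩ U).Nonempty}.Finite

/-- A homeomorphism is an isomorphism of E-graphs if it maps the vertices onto the vertices and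
the edges onto the edges. -/
def EGraph.IsIso {Y Y' : Type*} [TopologicalSpace Y] [TopologicalSpace Y']
    (Γ : EGraph Y) (Γ' : EGraph Y') (φ : Y ≃ₜ Y') : Prop :=
  φ '' Γ.vertices = Γ'.vertices ∧ (fun e : Set Y => φ '' e) '' Γ.edges = Γ'.edges

/-- `Y` is homeomorphic to some E-graph (living in the universe `u`). -/
def HomeomorphicToEGraph.{u, v} (Y : Type v) [TopologicalSpace Y] : Prop :=
  ∃ (W : Type u) (_ : TopologicalSpace W), Nonempty (EGraph W) ∧ Nonempty (Y ≃ₜ W)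

/-- Two points are equivalent if they lie in the same connected component of the same level set
of `c`. -/
def reebSetoid {X Y : Type*} [TopologicalSpace X] (c : X → Y) : Setoid X where
  r x y := y ∈ connectedComponentIn (c ⁻¹' {c x}) x
  iseqv :=
    { refl := fun x => mem_connectedComponentIn (by simp)
      symm := fun {x y} h => by
        have hy : y ∈ c ⁻¹' {c x} := connectedComponentIn_subset _ _ h
        rw [show c y = c x from hy, ← connectedComponentIn_eq h]
        exact mem_connectedComponentIn (by simp)
      trans := fun {x y z} h h' => by
        have hy : y ∈ c ⁻¹' {c x} := connectedComponentIn_subset _ _ h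
        rw [show c y = c x from hy, ← connectedComponentIn_eq h] at h'
        exact h' }

/-- The Reeb space of `c`, with the quotient topology. -/
abbrev ReebSpace {X Y : Type*} [TopologicalSpace X] (c : X → Y) : Type _ :=
  Quotient (reebSetoid c)

/-- The quotient map onto the Reeb space. -/
def reebMap {X Y : Type*} [TopologicalSpace X] (c : X → Y) : X → ReebSpace c :=
  Quotient.mk (reebSetoid c)

/-- `X ⊆ ℝⁿ` is an (embedded) smooth submanifold of dimension `d` without boundary: around each of
its points there is a smooth local diffeomorphism of the ambient space flattening `X` to a
`d`-dimensional coordinate subspace. -/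
def IsSmoothSubmanifold {n : ℕ} (d : ℕ) (X : Set (EuclideanSpace ℝ (Fin n))) : Prop :=
  ∃ k : ℕ, n = d + k ∧ ∀ x ∈ X,
    ∃ φ : OpenPartialHomeomorph (EuclideanSpace ℝ (Fin n))
        (EuclideanSpace ℝ (Fin d) × EuclideanSpace ℝ (Fin k)),
      x ∈ φ.source ∧ ContDiffOn ℝ ∞ φ φ.source ∧ ContDiffOn ℝ ∞ φ.symm φ.target ∧
        ∀ y ∈ φ.source, (y ∈ X ↔ (φ y).2 = 0)

/-- The tangent vectors to `X` at `x`: velocities of smooth curves in `X` through `x`. -/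
def tangentVectors {n : ℕ} (X : Set (EuclideanSpace ℝ (Fin n))) (x : EuclideanSpace ℝ (Fin n)) :
    Set (EuclideanSpace ℝ (Fin n)) :=
  {v | ∃ γ : ℝ → EuclideanSpace ℝ (Fin n), ContDiffAt ℝ ∞ γ 0 ∧ (∀ᶠ t in 𝓝 (0 : ℝ), γ t ∈ X) ∧
    γ 0 = x ∧ HasDerivAt γ v 0}

/-- `x` is a critical point of the restriction to the submanifold `X` of the smooth function `f`. -/
def IsCriticalPointOn {n : ℕ} (X : Set (EuclideanSpace ℝ (Fin n)))
    (f : EuclideanSpace ℝ (Fin n) → ℝ) (x : EuclideanSpace ℝ (Fin n)) : Prop :=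
  x ∈ X ∧ ∀ v ∈ tangentVectors X x, fderiv ℝ f x v = 0

/-- The function `e^{-1/x²} x sin²(1/x)`, extended by the value `0` at `x = 0` (the formula below
has this value there because of the factor `x`). -/
def c₀ (x : ℝ) : ℝ := Real.exp (-(1 / x ^ 2)) * x * Real.sin (1 / x) ^ 2

/-- With coordinates `(x₁, x₂, y, z)` on `ℝ^{m₁+m₂+2}`, where `y` has `m₁` and `z` has `m₂` entries,
the map
`(x₁ - c₀(x₂) - ∑ yⱼ², r₁₂ - ((x₁-p₁)²/r₁ + (x₂-p₂)²/r₂) - ∑ zⱼ²)`. -/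
def eMap (p₁ p₂ r₁ r₂ r₁₂ : ℝ) (m₁ m₂ : ℕ) (x : EuclideanSpace ℝ (Fin (m₁ + m₂ + 2))) :
    EuclideanSpace ℝ (Fin 2) :=
  !₂[x 0 - c₀ (x 1) - ∑ j : Fin m₁, x ⟨2 + j, by have := j.isLt; omega⟩ ^ 2,
    r₁₂ - ((x 0 - p₁) ^ 2 / r₁ + (x 1 - p₂) ^ 2 / r₂)
      - ∑ j : Fin m₂, x ⟨2 + m₁ + j, by have := j.isLt; omega⟩ ^ 2]

/-- The zero set of `eMap`. -/
def zeroManifold (p₁ p₂ r₁ r₂ r₁₂ : ℝ) (m₁ m₂ : ℕ) : Set (EuclideanSpace ℝ (Fin (m₁ + m₂ + 2))) :=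
  eMap p₁ p₂ r₁ r₂ r₁₂ m₁ m₂ ⁻¹' {0}

/-- The restriction of the projection to the first coordinate to the zero set of `eMap`. -/
def cFun (p₁ p₂ r₁ r₂ r₁₂ : ℝ) (m₁ m₂ : ℕ) (x : zeroManifold p₁ p₂ r₁ r₂ r₁₂ m₁ m₂) : ℝ :=
  (x : EuclideanSpace ℝ (Fin (m₁ + m₂ + 2))) 0

end

universe u

/-!
A point `(x₁, x₂, y, z)` of the zero set is determined up to the directions of `y` and `z` by the
point `(x₁, x₂)`, which ranges over the planar region `x₁ ≥ c₀ x₂` inside a disk through the origin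
and `(0, 1/π)`. The spheres of directions are connected because `m₁, m₂ > 1`, so the contours of the
height function correspond to the components of the vertical slices of this region. The graph
of `c₀` cuts the slices: it oscillates between the zeros `1/((k + 1) π)`, where it touches the axis
`x₁ = 0`, and one peak between any two consecutive zeros. Each zero therefore contributes a segment
of components which starts at the zero and merges with the others at the height of the peak below
it. The Reeb space is a comb with infinitely many teeth, whose lengths tend to zero and which
accumulate at the image of the origin.

Every point of an E-graph has a neighbourhood containing finitely many vertices, while the free ends
of the teeth, which could only be vertices, accumulate at the image of the origin. This is why the
comb is not an E-graph and the image of the origin has to be removed.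

The gradients of the two equations are linearly independent along the zero set, so its tangent
vectors form the kernel of the derivative. A point is critical for the height if and only if `y = 0`
and `x₂` is a critical point of `c₀`, or `z = 0` and `x₂` is the ordinate of the centre of the disk.
-/

namespace EGraph

variable {Y W : Type*} [TopologicalSpace Y] [TopologicalSpace W]

theorem mem_vertices_or_exists_mem_edge (Γ : EGraph Y) (y : Y) :
    y ∈ Γ.vertices ∨ ∃ e ∈ Γ.edges, y ∈ e :=
  (Γ.cover ▸ mem_univ y : y ∈ Γ.vertices ∪ ⋃₀ Γ.edges)

/-- The E-graph structure pulled back along a homeomorphism. -/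
def comap (Γ : EGraph W) (φ : Y ≃ₜ W) : EGraph Y where
  vertices := φ ⁻¹' Γ.vertices
  edges := image φ ⁻¹' Γ.edges
  t2 := have := Γ.t2; φ.symm.t2Space
  disjoint_vertices e he :=
    ((Γ.disjoint_vertices _ he).preimage φ).mono_left (subset_preimage_image φ e)
  disjoint_edges := fun e he f hf hef => (disjoint_image_iff φ.injective).1
    (Γ.disjoint_edges he hf (φ.injective.image_injective.ne hef))
  cover := by
    refine eq_univ_of_forall fun y => (Γ.mem_vertices_or_exists_mem_edge (φ y)).imp_right ?_
    rintro ⟨e, he, hy⟩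
    exact ⟨φ ⁻¹' e, by rwa [mem_preimage, image_preimage_eq e φ.surjective], hy⟩
  edge_homeo e he := (Γ.edge_homeo _ he).map (φ.image e).trans
  closure_diff_subset e he := by
    rw [← image_subset_iff, image_sdiff φ.injective, φ.image_closure]
    exact Γ.closure_diff_subset _ he
  closure_homeo e he :=
    have ψ := (φ.image (closure e)).trans (.setCongr (φ.image_closure e))
    (Γ.closure_homeo _ he).imp (.map ψ.trans) (.map ψ.trans)
  locally_finite y := by
    obtain ⟨U, hU, hv, he⟩ := Γ.locally_finite (φ y)
    refine ⟨φ ⁻¹' U, φ.continuous.continuousAt hU, hv.preimage (f := φ) φ.injective.injOn,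
      (he.preimage φ.injective.image_injective.injOn).subset ?_⟩
    rintro e ⟨hme, x, hx, hxU⟩
    exact ⟨hme, φ x, φ.image_closure e ▸ mem_image_of_mem φ hx, hxU⟩

theorem comap_isIso (Γ : EGraph W) (φ : Y ≃ₜ W) : (Γ.comap φ).IsIso Γ φ :=
  ⟨image_preimage_eq _ φ.surjective, image_preimage_eq _ φ.surjective.image_surjective⟩

theorem isOpen_of_mem_edges (Γ : EGraph Y) {e : Set Y} (he : e ∈ Γ.edges) : IsOpen e := by
  have := Γ.t2
  rw [isOpen_iff_mem_nhds]
  intro y hy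
  obtain ⟨U, hU, hv, hfin⟩ := Γ.locally_finite y
  set others := {f ∈ Γ.edges | (closure f ∩ U).Nonempty} \ {e}
  have hyv : y ∉ Γ.vertices := disjoint_left.1 (Γ.disjoint_vertices e he) hy
  have hclosed : IsClosed ((Γ.vertices ∩ U) ∪ ⋃ f ∈ others, closure f) :=
    hv.isClosed.union ((hfin.subset sdiff_subset).isClosed_biUnion fun _ _ => isClosed_closure)
  have hy_others : y ∉ (Γ.vertices ∩ U) ∪ ⋃ f ∈ others, closure f := by
    rintro (h | h)
    · exact hyv h.1
    · obtain ⟨f, ⟨⟨hf, -⟩, hfe⟩, hyf⟩ := mem_iUnion₂.1 h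
      have hyf' : y ∉ f := disjoint_right.1 (Γ.disjoint_edges hf he hfe) hy
      exact hyv (Γ.closure_diff_subset f hf ⟨hyf, hyf'⟩)
  filter_upwards [hU, hclosed.isOpen_compl.mem_nhds hy_others] with z hzU hz
  rcases Γ.mem_vertices_or_exists_mem_edge z with hzv | ⟨f, hf, hzf⟩
  · exact absurd (Or.inl ⟨hzv, hzU⟩) hz
  · by_contra hze
    have hfe : f ≠ e := fun h => hze (h ▸ hzf)
    exact hz (Or.inr (mem_iUnion₂.2
      ⟨f, ⟨⟨hf, z, subset_closure hzf, hzU⟩, hfe⟩, subset_closure hzf⟩))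

end EGraph

/-- A point with arbitrarily small neighbourhoods that stay preconnected when the point is removed.
In an E-graph such points are vertices, so they do not accumulate. -/
def IsEndPoint {Y : Type*} [TopologicalSpace Y] (y : Y) : Prop :=
  ∀ U ∈ 𝓝 y, ∃ V ∈ 𝓝 y, V ⊆ U ∧ IsPreconnected (V \ {y})

theorem not_isEndPoint_real (x : ℝ) : ¬ IsEndPoint x := by
  intro h
  obtain ⟨V, hV, -, hc⟩ := h univ Filter.univ_mem
  obtain ⟨ε, hε, hball⟩ := Metric.mem_nhds_iff.1 hV
  rw [Real.ball_eq_Ioo] at hball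
  have hleft : x - ε / 2 ∈ V \ {x} := ⟨hball ⟨by linarith, by linarith⟩, by simp [hε.ne']⟩
  have hright : x + ε / 2 ∈ V \ {x} := ⟨hball ⟨by linarith, by linarith⟩, by simp [hε.ne']⟩
  exact (hc.Icc_subset hleft hright ⟨by linarith, by linarith⟩).2 rfl

theorem IsEndPoint.of_isOpenEmbedding {Y W : Type*} [TopologicalSpace Y] [TopologicalSpace W]
    {f : W → Y} (hf : IsOpenEmbedding f) {w : W} (h : IsEndPoint (f w)) :
    IsEndPoint w := by
  intro U hU
  obtain ⟨V, hV, hVU, hc⟩ := h _ (hf.image_mem_nhds.2 hU)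
  refine ⟨f ⁻¹' V, hf.continuous.continuousAt hV, ?_, ?_⟩
  · exact (preimage_mono hVU).trans (preimage_image_eq U hf.injective).subset
  · have hpre : f ⁻¹' V \ {w} = f ⁻¹' (V \ {f w}) := by
      rw [preimage_sdiff, ← image_singleton, preimage_image_eq _ hf.injective]
    rw [hpre]
    exact hc.preimage_of_isOpenMap hf.injective hf.isOpenMap
      ((sdiff_subset.trans hVU).trans (image_subset_range f U))

theorem EGraph.mem_vertices_of_isEndPoint {Y : Type*} [TopologicalSpace Y] (Γ : EGraph Y) {y : Y}
    (h : IsEndPoint y) : y ∈ Γ.vertices := by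
  refine (Γ.mem_vertices_or_exists_mem_edge y).resolve_right ?_
  rintro ⟨e, he, hy⟩
  obtain ⟨ψ⟩ := Γ.edge_homeo e he
  have hψ : IsOpenEmbedding (Subtype.val ∘ ψ.symm) :=
    (Γ.isOpen_of_mem_edges he).isOpenEmbedding_subtypeVal.comp ψ.symm.isOpenEmbedding
  have hval : (Subtype.val ∘ ψ.symm) (ψ ⟨y, hy⟩) = y := by simp
  exact not_isEndPoint_real _ (.of_isOpenEmbedding hψ (hval ▸ h))

theorem HomeomorphicToEGraph.exists_nhds_finite_isEndPoint {Y : Type*} [TopologicalSpace Y]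
    (h : HomeomorphicToEGraph.{u} Y) (y : Y) : ∃ U ∈ 𝓝 y, ({x | IsEndPoint x} ∩ U).Finite := by
  obtain ⟨W, _, ⟨Γ⟩, ⟨φ⟩⟩ := h
  obtain ⟨U, hU, hv, -⟩ := (Γ.comap φ).locally_finite y
  exact ⟨U, hU, hv.subset (inter_subset_inter_left _ fun _ hx =>
    (Γ.comap φ).mem_vertices_of_isEndPoint hx)⟩

theorem isEmbedding_domRestrict_of_isCompact {X E : Type*} [TopologicalSpace X] [TopologicalSpace E]
    [T2Space E] {K A : Set X} {f : X → E} (hK : IsCompact K) (hf : ContinuousOn f K)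
    (hinj : InjOn f K) (hA : A ⊆ K) : IsEmbedding (A.domRestrict f) := by
  have := isCompact_iff_compactSpace.1 hK
  exact (hf.domRestrict.isClosedEmbedding hinj.injective).isEmbedding.comp (.inclusion hA)

theorem nonempty_homeomorph_image_of_isCompact {X E : Type*} [TopologicalSpace X]
    [TopologicalSpace E] [T2Space E] {K A : Set X} {f : X → E} (hK : IsCompact K)
    (hf : ContinuousOn f K) (hinj : InjOn f K) (hA : A ⊆ K) : Nonempty (f '' A ≃ₜ A) :=
  ⟨(Homeomorph.setCongr (range_domRestrict f A).symm).trans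
    (isEmbedding_domRestrict_of_isCompact hK hf hinj hA).toHomeomorph.symm⟩

theorem nonempty_homeomorph_preimage {Y E : Type*} [TopologicalSpace Y] [TopologicalSpace E]
    {j : Y → E} (hj : IsEmbedding j) {B : Set E} (hB : B ⊆ range j) : Nonempty (j ⁻¹' B ≃ₜ B) :=
  ⟨(hj.homeomorphImage _).trans (.setCongr (image_preimage_eq_of_subset hB))⟩

theorem nonempty_Ioo_homeomorph_real {a b : ℝ} (hab : a < b) : Nonempty (Ioo a b ≃ₜ ℝ) := by
  have hpos : 0 < (b - a) / 2 := by linarith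
  have himage : affineHomeomorph ((b - a) / 2) ((a + b) / 2) hpos.ne' '' Ioo (-1) 1 = Ioo a b := by
    rw [affineHomeomorph_image_Ioo _ _ _ _ hpos]
    congr 1 <;> ring
  exact ⟨((Homeomorph.setCongr himage.symm).trans (Homeomorph.image _ _).symm).trans
    (orderIsoIooNegOneOne ℝ).toHomeomorph.symm⟩

/-- A decomposition of the subset `S` of `E` into the vertex set `V` and the interiors of the arcs
`γ i '' [a i, b i]`, whose ends are vertices; it is locally finite at the points of `S`. -/
structure IsArcDecomposition {E ι : Type*} [TopologicalSpace E] (S V : Set E) (a b : ι → ℝ)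
    (γ : ι → ℝ → E) : Prop where
  lt : ∀ i, a i < b i
  continuousOn : ∀ i, ContinuousOn (γ i) (Icc (a i) (b i))
  injOn : ∀ i, InjOn (γ i) (Icc (a i) (b i))
  image_subset : ∀ i, γ i '' Icc (a i) (b i) ⊆ S
  left_mem : ∀ i, γ i (a i) ∈ V
  right_mem : ∀ i, γ i (b i) ∈ V
  disjoint_vertices : ∀ i, Disjoint (γ i '' Ioo (a i) (b i)) V
  disjoint_arcs : Pairwise (Function.onFun Disjoint fun i => γ i '' Ioo (a i) (b i))
  cover : S ⊆ V ∪ ⋃ i, γ i '' Ioo (a i) (b i)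
  locally_finite : ∀ x ∈ S, ∃ U ∈ 𝓝 x,
    (V ∩ U).Finite ∧ {i | (γ i '' Icc (a i) (b i) ∩ U).Nonempty}.Finite

namespace IsArcDecomposition

variable {Y E ι : Type*} [TopologicalSpace Y] [TopologicalSpace E] [T2Space E] {S V : Set E}
  {a b : ι → ℝ} {γ : ι → ℝ → E} {j : Y → E}

theorem closure_preimage_image_Ioo (h : IsArcDecomposition S V a b γ) (hj : IsEmbedding j)
    (hS : range j = S) (i : ι) :
    closure (j ⁻¹' (γ i '' Ioo (a i) (b i))) = j ⁻¹' (γ i '' Icc (a i) (b i)) := by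
  have hclosure : closure (Ioo (a i) (b i)) = Icc (a i) (b i) := closure_Ioo (h.lt i).ne
  have hrange : γ i '' Ioo (a i) (b i) ⊆ range j :=
    hS ▸ (image_mono Ioo_subset_Icc_self).trans (h.image_subset i)
  rw [hj.closure_eq_preimage_closure_image, image_preimage_eq_of_subset hrange,
    ← image_closure_of_isCompact (hclosure ▸ isCompact_Icc) (hclosure ▸ h.continuousOn i), hclosure]

/-- The E-graph on a space `Y`, embedded by `j`, which is given by a decomposition of `range j` into
arcs. -/
def eGraph (h : IsArcDecomposition S V a b γ) (hj : IsEmbedding j) (hS : range j = S) :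
    EGraph Y where
  vertices := j ⁻¹' V
  edges := range fun i => j ⁻¹' (γ i '' Ioo (a i) (b i))
  t2 := hj.t2Space
  disjoint_vertices := forall_mem_range.2 fun i => (h.disjoint_vertices i).preimage j
  disjoint_edges := by
    rintro _ ⟨i, rfl⟩ _ ⟨i', rfl⟩ hne
    exact (h.disjoint_arcs fun hii' : i = i' => hne (by rw [hii'])).preimage j
  cover := by
    refine eq_univ_of_forall fun y => (h.cover (hS ▸ mem_range_self y)).imp id fun hy => ?_
    obtain ⟨i, hi⟩ := mem_iUnion.1 hy
    exact ⟨_, ⟨i, rfl⟩, hi⟩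
  edge_homeo := forall_mem_range.2 fun i => by
    obtain ⟨φ⟩ := nonempty_homeomorph_preimage hj
      (hS ▸ (image_mono Ioo_subset_Icc_self).trans (h.image_subset i))
    obtain ⟨ψ⟩ := nonempty_homeomorph_image_of_isCompact isCompact_Icc (h.continuousOn i)
      (h.injOn i) Ioo_subset_Icc_self
    exact (nonempty_Ioo_homeomorph_real (h.lt i)).map (φ.trans ψ).trans
  closure_diff_subset := forall_mem_range.2 fun i => by
    rw [h.closure_preimage_image_Ioo hj hS i, ← preimage_sdiff, ← (h.injOn i).image_sdiff_subset
      Ioo_subset_Icc_self, Icc_sdiff_Ioo_same (h.lt i).le, image_pair]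
    exact preimage_mono (pair_subset (h.left_mem i) (h.right_mem i))
  closure_homeo := forall_mem_range.2 fun i => by
    rw [h.closure_preimage_image_Ioo hj hS i]
    obtain ⟨φ⟩ := nonempty_homeomorph_preimage hj (hS ▸ h.image_subset i)
    obtain ⟨ψ⟩ := nonempty_homeomorph_image_of_isCompact isCompact_Icc (h.continuousOn i)
      (h.injOn i) Subset.rfl
    exact Or.inl ⟨(φ.trans ψ).trans
      ((iccHomeoI _ _ (h.lt i)).trans (iccHomeoI (-1) 1 (by norm_num)).symm)⟩
  locally_finite y := by
    obtain ⟨U, hU, hV, harcs⟩ := h.locally_finite (j y) (hS ▸ mem_range_self y)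
    have hedges := harcs.image fun i => j ⁻¹' (γ i '' Ioo (a i) (b i))
    refine ⟨j ⁻¹' U, hj.continuous.continuousAt hU, hV.preimage (f := j) hj.injective.injOn,
      hedges.subset ?_⟩
    rintro _ ⟨⟨i, rfl⟩, x, hx, hxU⟩
    rw [h.closure_preimage_image_Ioo hj hS i] at hx
    exact ⟨i, ⟨j x, hx, hxU⟩, rfl⟩

end IsArcDecomposition

theorem locallyConnectedSpace_of_isPreconnected_inter_ball {X : Type*} [PseudoMetricSpace X]
    {s : Set X} (h : ∀ x ∈ s, ∃ᶠ ε in 𝓝[>] 0, IsPreconnected (s ∩ Metric.ball x ε)) :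
    LocallyConnectedSpace s := by
  rw [locallyConnectedSpace_iff_connected_subsets]
  intro x U hU
  obtain ⟨δ, hδ, hball⟩ := Metric.mem_nhds_iff.1 hU
  obtain ⟨ε, hε, hε0, hεδ⟩ := ((h x x.2).and_eventually (Ioo_mem_nhdsGT hδ)).exists
  refine ⟨Metric.ball x ε, Metric.ball_mem_nhds x hε0, ?_, (Metric.ball_subset_ball hεδ.le).trans
    hball⟩
  rwa [← IsInducing.subtypeVal.isPreconnected_image, ← Subtype.preimage_ball,
    Subtype.image_preimage_coe]

theorem isEndPoint_of_isPreconnected_inter_ball {X : Type*} [PseudoMetricSpace X] {s : Set X}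
    {x : s} (h : ∃ᶠ ε in 𝓝[>] 0, IsPreconnected ((s ∩ Metric.ball (x : X) ε) \ {(x : X)})) :
    IsEndPoint x := by
  intro U hU
  obtain ⟨δ, hδ, hball⟩ := Metric.mem_nhds_iff.1 hU
  obtain ⟨ε, hε, hε0, hεδ⟩ := (h.and_eventually (Ioo_mem_nhdsGT hδ)).exists
  refine ⟨Metric.ball x ε, Metric.ball_mem_nhds x hε0, (Metric.ball_subset_ball hεδ.le).trans
    hball, ?_⟩
  rwa [← IsInducing.subtypeVal.isPreconnected_image, image_sdiff Subtype.val_injective,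
    image_singleton, ← Subtype.preimage_ball, Subtype.image_preimage_coe]

/-- The comb with the diagonal of `[0, H 0]²` as its spine and with horizontal teeth from the spine
to the points `(0, H k)`, `1 ≤ k`. -/
def combSet (H : ℕ → ℝ) : Set (ℝ × ℝ) :=
  {x | 0 ≤ x.1 ∧ x.1 ≤ x.2 ∧ x.2 ≤ H 0 ∧ (x.1 = x.2 ∨ ∃ k, x.2 = H (k + 1))}

section combSet

variable {H : ℕ → ℝ}

theorem diag_mem_combSet {t : ℝ} (h0 : 0 ≤ t) (ht : t ≤ H 0) : (t, t) ∈ combSet H :=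
  ⟨h0, le_rfl, ht, Or.inl rfl⟩

theorem mk_mem_combSet_of_le {x : ℝ × ℝ} (hx : x ∈ combSet H) {t : ℝ} (ht : t ∈ Icc x.1 x.2) :
    (t, x.2) ∈ combSet H := by
  obtain ⟨h0, -, h2, h3⟩ := hx
  exact ⟨h0.trans ht.1, ht.2, h2, h3.imp_left fun h => le_antisymm ht.2 (h.symm.trans_le ht.1)⟩

-- Each point of the set is joined to the spine by the horizontal segment on its right.
theorem isPreconnected_combSet_inter_prod (s : ℝ) (J : Set ℝ) [J.OrdConnected] :
    IsPreconnected (combSet H ∩ Ioi s ×ˢ J) := by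
  rcases (combSet H ∩ Ioi s ×ˢ J).eq_empty_or_nonempty with h | ⟨x₀, hx₀⟩
  · rw [h]
    exact isPreconnected_empty
  set spine := (fun t : ℝ => (t, t)) '' (Icc 0 (H 0) ∩ Ioi s ∩ J)
  have hspine : IsPreconnected spine :=
    ((ordConnected_Icc.inter ordConnected_Ioi).inter ‹_›).isPreconnected.image _ (by fun_prop)
  have hspine_subset : spine ⊆ combSet H ∩ Ioi s ×ˢ J := by
    rintro _ ⟨t, ⟨⟨ht, hts⟩, htJ⟩, rfl⟩
    exact ⟨diag_mem_combSet ht.1 ht.2, hts, htJ⟩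
  have hmem_spine : ∀ x ∈ combSet H ∩ Ioi s ×ˢ J, (x.2, x.2) ∈ spine :=
    fun x ⟨hx, hs, hJ⟩ => ⟨x.2, ⟨⟨⟨hx.1.trans hx.2.1, hx.2.2.1⟩, hs.trans_le hx.2.1⟩, hJ⟩, rfl⟩
  refine isPreconnected_of_forall (x₀.2, x₀.2) fun x hx => ?_
  have hsegment : IsPreconnected ((fun t : ℝ => (t, x.2)) '' Icc x.1 x.2) :=
    isPreconnected_Icc.image _ (by fun_prop)
  refine ⟨spine ∪ (fun t : ℝ => (t, x.2)) '' Icc x.1 x.2, union_subset hspine_subset ?_,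
    Or.inl (hmem_spine x₀ hx₀), Or.inr ⟨x.1, left_mem_Icc.2 hx.1.2.1, rfl⟩,
    hspine.union (x.2, x.2) (hmem_spine x hx) ⟨x.2, right_mem_Icc.2 hx.1.2.1, rfl⟩ hsegment⟩
  rintro _ ⟨t, ht, rfl⟩
  exact ⟨mk_mem_combSet_of_le hx.1 ht, hx.2.1.trans_le ht.1, hx.2.2⟩

theorem isPreconnected_combSet : IsPreconnected (combSet H) := by
  have h : combSet H ∩ Ioi (-1) ×ˢ univ = combSet H :=
    inter_eq_left.2 fun x hx => ⟨neg_one_lt_zero.trans_le hx.1, mem_univ _⟩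
  exact h ▸ isPreconnected_combSet_inter_prod (-1) univ

theorem isPreconnected_combSet_inter_ball_diag (t ε : ℝ) :
    IsPreconnected (combSet H ∩ Metric.ball (t, t) ε) := by
  have h : combSet H ∩ Metric.ball (t, t) ε =
      combSet H ∩ Ioi (t - ε) ×ˢ Ioo (t - ε) (t + ε) := by
    ext ⟨a, b⟩
    rw [← ball_prod_same, Real.ball_eq_Ioo]
    exact and_congr_right fun hx => ⟨fun h => ⟨h.1.1, h.2⟩,
      fun h => ⟨⟨h.1, hx.2.1.trans_lt h.2.2⟩, h.2⟩⟩
  exact h ▸ isPreconnected_combSet_inter_prod _ _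

end combSet

/-- A strictly decreasing sequence of positive numbers which tends to `0`: the heights of the top
of a comb and of its teeth. -/
structure IsCombSeq (H : ℕ → ℝ) : Prop where
  anti : StrictAnti H
  pos : ∀ k, 0 < H k
  lim : Filter.Tendsto H Filter.atTop (𝓝 0)

namespace IsCombSeq

variable {H : ℕ → ℝ}

theorem tooth_mem_combSet (hH : IsCombSeq H) {k : ℕ} {t : ℝ} (ht : t ∈ Icc 0 (H (k + 1))) :
    (t, H (k + 1)) ∈ combSet H :=
  ⟨ht.1, ht.2, hH.anti.antitone (Nat.zero_le _), Or.inr ⟨k, rfl⟩⟩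

theorem eq_of_mem_Ioo (hH : IsCombSeq H) {j k : ℕ} {t : ℝ} (hj : t ∈ Ioo (H (j + 1)) (H j))
    (hk : t ∈ Ioo (H (k + 1)) (H k)) : j = k := by
  have h1 := hH.anti.lt_iff_gt.1 (hj.1.trans hk.2)
  have h2 := hH.anti.lt_iff_gt.1 (hk.1.trans hj.2)
  omega

theorem notMem_Ioo (hH : IsCombSeq H) (j k : ℕ) : H j ∉ Ioo (H (k + 1)) (H k) := fun h => by
  have h1 := hH.anti.lt_iff_gt.1 h.1
  have h2 := hH.anti.lt_iff_gt.1 h.2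
  omega

theorem exists_eq_or_mem_Ioo (hH : IsCombSeq H) {t : ℝ} (ht0 : 0 < t) (ht : t ≤ H 0) :
    (∃ k, t = H k) ∨ ∃ k, t ∈ Ioo (H (k + 1)) (H k) := by
  classical
  have hex : ∃ n, H n ≤ t := ((hH.lim.eventually (gt_mem_nhds ht0)).exists).imp fun _ hn => hn.le
  rcases (Nat.find_spec hex).eq_or_lt with heq | hlt
  · exact Or.inl ⟨_, heq.symm⟩
  · rcases hn : Nat.find hex with _ | n
    · exact absurd ht (hn ▸ hlt).not_ge
    · exact Or.inr ⟨n, by rwa [← hn], not_le.1 (Nat.find_min hex (by omega))⟩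

theorem finite_setOf_lt (hH : IsCombSeq H) {c : ℝ} (hc : 0 < c) : {k | c < H k}.Finite := by
  have h : ∀ᶠ k in Filter.cofinite, H k < c := Nat.cofinite_eq_atTop ▸ hH.lim.eventually_lt_const hc
  exact (Filter.eventually_cofinite.1 h).subset fun k hk => not_lt.2 (le_of_lt hk)

theorem isClosed_insert_range_succ (hH : IsCombSeq H) :
    IsClosed (insert 0 (range fun k => H (k + 1))) :=
  (hH.lim.comp (Filter.tendsto_add_atTop_nat 1)).isCompact_insert_range.isClosed

theorem isCompact_combSet (hH : IsCombSeq H) : IsCompact (combSet H) := by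
  have h : combSet H = Icc 0 (H 0) ×ˢ Icc 0 (H 0) ∩ ({x | x.1 ≤ x.2} ∩
      ({x | x.1 = x.2} ∪ Prod.snd ⁻¹' (insert 0 (range fun k => H (k + 1))))) := by
    ext ⟨t, u⟩
    constructor
    · rintro ⟨h0, h1, h2, h3⟩
      exact ⟨⟨⟨h0, h1.trans h2⟩, h0.trans h1, h2⟩, h1,
        h3.imp id fun ⟨k, hk⟩ => Or.inr ⟨k, hk.symm⟩⟩
    · rintro ⟨⟨⟨h0, -⟩, -, h2⟩, h1, h3 | h3 | ⟨k, h3⟩⟩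
      · exact ⟨h0, h1, h2, Or.inl h3⟩
      · exact ⟨h0, h1, h2, Or.inl (le_antisymm h1 (h3.trans_le h0))⟩
      · exact ⟨h0, h1, h2, Or.inr ⟨k, h3.symm⟩⟩
  rw [h]
  exact (isCompact_Icc.prod isCompact_Icc).inter_right
    ((isClosed_le continuous_fst continuous_snd).inter ((isClosed_eq continuous_fst
      continuous_snd).union (hH.isClosed_insert_range_succ.preimage continuous_snd)))

theorem eventually_combSet_inter_ball_tooth (hH : IsCombSeq H) {k : ℕ} {t : ℝ}
    (ht : t < H (k + 1)) : ∀ᶠ ε in 𝓝[>] 0, combSet H ∩ Metric.ball (t, H (k + 1)) ε =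
      (fun s => (s, H (k + 1))) '' (Ici 0 ∩ Ioo (t - ε) (t + ε)) := by
  have hprev : 0 < H k - H (k + 1) := sub_pos.2 (hH.anti k.lt_succ_self)
  have hnext : 0 < H (k + 1) - H (k + 2) := sub_pos.2 (hH.anti (k + 1).lt_succ_self)
  filter_upwards [Ioo_mem_nhdsGT (half_pos (sub_pos.2 ht)), Ioo_mem_nhdsGT hprev,
    Ioo_mem_nhdsGT hnext] with ε hεt hεprev hεnext
  simp only [mem_Ioo] at hεt hεprev hεnext
  rw [← ball_prod_same, Real.ball_eq_Ioo, Real.ball_eq_Ioo]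
  ext ⟨a, b⟩
  constructor
  · rintro ⟨⟨h0, -, -, hdiag | ⟨j, hj⟩⟩, ha, hb⟩ <;> dsimp only at *
    · linarith [ha.2, hb.1]
    · have h1 := hH.anti.lt_iff_gt.1 (show H (j + 1) < H k by linarith [hb.2])
      have h2 := hH.anti.lt_iff_gt.1 (show H (k + 2) < H (j + 1) by linarith [hb.1])
      obtain rfl : j = k := by omega
      exact ⟨a, ⟨h0, ha⟩, by rw [hj]⟩
  · rintro ⟨s, ⟨h0, hs⟩, h⟩
    obtain ⟨rfl, rfl⟩ := Prod.mk.inj h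
    exact ⟨hH.tooth_mem_combSet ⟨h0, by linarith [hs.2]⟩, hs, by linarith, by linarith⟩

theorem locallyConnectedSpace_combSet (hH : IsCombSeq H) : LocallyConnectedSpace (combSet H) := by
  refine locallyConnectedSpace_of_isPreconnected_inter_ball ?_
  rintro ⟨t, u⟩ ⟨-, h1, -, h3⟩
  dsimp only at h1 h3
  rcases h1.eq_or_lt with rfl | hlt
  · exact .of_forall (isPreconnected_combSet_inter_ball_diag t)
  · obtain ⟨k, rfl⟩ := h3.resolve_left hlt.ne
    refine ((hH.eventually_combSet_inter_ball_tooth hlt).mono fun ε hε => ?_).frequently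
    exact hε ▸ (ordConnected_Ici.inter ordConnected_Ioo).isPreconnected.image _ (by fun_prop)

theorem isPeanoContinuum_combSet (hH : IsCombSeq H) : IsPeanoContinuum (combSet H) where
  separable := inferInstance
  compact := isCompact_iff_compactSpace.1 hH.isCompact_combSet
  connected := isConnected_iff_connectedSpace.1
    ⟨⟨(0, 0), diag_mem_combSet le_rfl (hH.pos 0).le⟩, isPreconnected_combSet⟩
  locallyConnected := hH.locallyConnectedSpace_combSet
  metrizable := inferInstance

theorem snd_pos_of_mem_combSet {x : ℝ × ℝ} (hx : x ∈ combSet H \ {(0, 0)}) : 0 < x.2 := by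
  obtain ⟨⟨h0, h1, -⟩, hne⟩ := hx
  refine (h0.trans h1).lt_of_ne fun h => hne ?_
  exact Prod.ext (le_antisymm (h1.trans_eq h.symm) h0) h.symm

/-- The lower end of the spine of a comb, at which its teeth accumulate. -/
def tip (hH : IsCombSeq H) : combSet H :=
  ⟨(0, 0), diag_mem_combSet le_rfl (hH.pos 0).le⟩

theorem ne_tip_iff (hH : IsCombSeq H) {x : combSet H} : x ≠ hH.tip ↔ 0 < x.1.2 :=
  ⟨fun h => snd_pos_of_mem_combSet ⟨x.2, fun h' => h (Subtype.ext h')⟩,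
    fun h h' => (congrArg (fun y : combSet H => y.1.2) h').not_gt h⟩

/-- The ends of the teeth and the points at which the teeth meet the spine. -/
def vertexSet (H : ℕ → ℝ) : Set (ℝ × ℝ) :=
  range (fun k => (H k, H k)) ∪ range fun k => (0, H (k + 1))

/-- The lower ends of the parameter intervals of the pieces of the spine (on the left) and of the
teeth (on the right) of a comb. -/
def arcStart (H : ℕ → ℝ) : ℕ ⊕ ℕ → ℝ := Sum.elim (fun k => H (k + 1)) 0

/-- The upper ends of the parameter intervals of the pieces of the spine and of the teeth. -/
def arcEnd (H : ℕ → ℝ) : ℕ ⊕ ℕ → ℝ := Sum.elim H fun k => H (k + 1)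

/-- The pieces of the spine and the teeth of a comb, as arcs parametrized by their first coordinate.
-/
def arc (H : ℕ → ℝ) : ℕ ⊕ ℕ → ℝ → ℝ × ℝ :=
  Sum.elim (fun _ t => (t, t)) fun k t => (t, H (k + 1))

@[fun_prop]
theorem continuous_arc (i : ℕ ⊕ ℕ) : Continuous (arc H i) := by
  rcases i with k | k <;> dsimp only [arc, Sum.elim_inl, Sum.elim_inr] <;> fun_prop

@[simp]
theorem arc_fst (i : ℕ ⊕ ℕ) (t : ℝ) : (arc H i t).1 = t := by
  cases i <;> rfl

theorem arc_injective (i : ℕ ⊕ ℕ) : Function.Injective (arc H i) :=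
  Function.LeftInverse.injective (g := Prod.fst) (arc_fst i)

theorem arcStart_lt_arcEnd (hH : IsCombSeq H) : ∀ i, arcStart H i < arcEnd H i
  | .inl k => hH.anti k.lt_succ_self
  | .inr k => hH.pos (k + 1)

theorem arc_mem_combSet (hH : IsCombSeq H) {i : ℕ ⊕ ℕ} {t : ℝ}
    (ht : t ∈ Icc (arcStart H i) (arcEnd H i)) : arc H i t ∈ combSet H \ {(0, 0)} := by
  have hne : (arc H i t).2 ≠ 0 := by
    rcases i with k | k
    · exact ((hH.pos (k + 1)).trans_le ht.1).ne'
    · exact (hH.pos (k + 1)).ne'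
  refine ⟨?_, fun h => hne (congrArg Prod.snd h)⟩
  rcases i with k | k
  · exact diag_mem_combSet ((hH.pos (k + 1)).le.trans ht.1)
      (ht.2.trans (hH.anti.antitone (Nat.zero_le k)))
  · exact hH.tooth_mem_combSet ht

theorem disjoint_arc_vertexSet (hH : IsCombSeq H) (i : ℕ ⊕ ℕ) :
    Disjoint (arc H i '' Ioo (arcStart H i) (arcEnd H i)) (vertexSet H) := by
  rw [disjoint_left]
  rintro _ ⟨t, ht, rfl⟩ (⟨j, h⟩ | ⟨j, h⟩) <;>
    obtain rfl := (congrArg Prod.fst h).trans (arc_fst i t) <;>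
    have hsnd := congrArg Prod.snd h <;> rcases i with k | k
  · exact hH.notMem_Ioo j k ht
  · exact ht.2.ne hsnd
  · exact (hH.pos (j + 1)).ne' hsnd
  · exact ht.1.false

theorem pairwise_disjoint_arc (hH : IsCombSeq H) :
    Pairwise (Function.onFun Disjoint fun i => arc H i '' Ioo (arcStart H i) (arcEnd H i)) := by
  intro i i' hne
  rw [Function.onFun, disjoint_left]
  rintro _ ⟨t, ht, rfl⟩ ⟨t', ht', h⟩
  obtain rfl : t' = t := by simpa only [arc_fst] using congrArg Prod.fst h
  have hsnd := congrArg Prod.snd h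
  rcases i with k | k <;> rcases i' with k' | k'
  · exact hne (congrArg _ (hH.eq_of_mem_Ioo ht ht'))
  · exact ht'.2.ne hsnd.symm
  · exact ht.2.ne hsnd
  · exact hne (congrArg _ (Nat.succ_injective (hH.anti.injective hsnd.symm)))

theorem exists_mem_arc (hH : IsCombSeq H) {x : ℝ × ℝ} (hx : x ∈ combSet H \ {(0, 0)}) :
    x ∈ vertexSet H ∪ ⋃ i, arc H i '' Ioo (arcStart H i) (arcEnd H i) := by
  obtain ⟨t, u⟩ := x
  have hu : 0 < u := snd_pos_of_mem_combSet hx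
  obtain ⟨h0, htu, hu0, h⟩ := hx.1
  dsimp only at h0 htu hu0 h
  rcases htu.eq_or_lt with rfl | hlt
  · rcases hH.exists_eq_or_mem_Ioo hu hu0 with ⟨k, rfl⟩ | ⟨k, hk⟩
    · exact Or.inl (Or.inl ⟨k, rfl⟩)
    · exact Or.inr (mem_iUnion.2 ⟨.inl k, t, hk, rfl⟩)
  · obtain ⟨k, rfl⟩ := h.resolve_left hlt.ne
    rcases h0.eq_or_lt with rfl | h0
    · exact Or.inl (Or.inr ⟨k, rfl⟩)
    · exact Or.inr (mem_iUnion.2 ⟨.inr k, t, ⟨h0, hlt⟩, rfl⟩)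

theorem finite_vertexSet_inter (hH : IsCombSeq H) {c : ℝ} (hc : 0 < c) :
    (vertexSet H ∩ {x | c < x.2}).Finite := by
  have hfin := hH.finite_setOf_lt hc
  refine ((hfin.image fun k => (H k, H k)).union ((hfin.preimage
    (Nat.succ_injective.injOn)).image fun k => (0, H (k + 1)))).subset ?_
  rintro _ ⟨⟨k, rfl⟩ | ⟨k, rfl⟩, hk⟩
  · exact Or.inl ⟨k, hk, rfl⟩
  · exact Or.inr ⟨k, hk, rfl⟩

theorem finite_setOf_arc_inter (hH : IsCombSeq H) {c : ℝ} (hc : 0 < c) :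
    {i | (arc H i '' Icc (arcStart H i) (arcEnd H i) ∩ {x | c < x.2}).Nonempty}.Finite := by
  have hfin := hH.finite_setOf_lt hc
  refine ((hfin.image Sum.inl).union ((hfin.preimage
    (Nat.succ_injective.injOn)).image Sum.inr)).subset ?_
  rintro (k | k) ⟨_, ⟨t, ht, rfl⟩, htc⟩
  · exact Or.inl ⟨k, htc.out.trans_le ht.2, rfl⟩
  · exact Or.inr ⟨k, htc, rfl⟩

theorem isArcDecomposition (hH : IsCombSeq H) :
    IsArcDecomposition (combSet H \ {(0, 0)}) (vertexSet H) (arcStart H) (arcEnd H) (arc H) where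
  lt := hH.arcStart_lt_arcEnd
  continuousOn i := (continuous_arc i).continuousOn
  injOn i := (arc_injective i).injOn
  image_subset _ := image_subset_iff.2 fun _ => hH.arc_mem_combSet
  left_mem
    | .inl k => Or.inl ⟨k + 1, rfl⟩
    | .inr k => Or.inr ⟨k, rfl⟩
  right_mem
    | .inl k => Or.inl ⟨k, rfl⟩
    | .inr k => Or.inl ⟨k + 1, rfl⟩
  disjoint_vertices := hH.disjoint_arc_vertexSet
  disjoint_arcs := hH.pairwise_disjoint_arc
  cover _ := hH.exists_mem_arc
  locally_finite x hx := by
    have hpos : 0 < x.2 := snd_pos_of_mem_combSet hx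
    exact ⟨{y | x.2 / 2 < y.2}, (isOpen_lt continuous_const continuous_snd).mem_nhds
      (half_lt_self hpos), hH.finite_vertexSet_inter (half_pos hpos),
      hH.finite_setOf_arc_inter (half_pos hpos)⟩

theorem range_coe_ne_tip (hH : IsCombSeq H) :
    range (fun x : {x : combSet H // x ≠ hH.tip} => (x : ℝ × ℝ)) = combSet H \ {(0, 0)} := by
  ext x
  refine ⟨?_, fun h => ⟨⟨⟨x, h.1⟩, fun h' => h.2 (congrArg Subtype.val h')⟩, rfl⟩⟩
  rintro ⟨y, rfl⟩
  exact ⟨y.1.2, fun h => y.2 (Subtype.ext h)⟩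

/-- The E-graph structure on a comb without its tip. -/
def eGraph (hH : IsCombSeq H) : EGraph {x : combSet H // x ≠ hH.tip} :=
  hH.isArcDecomposition.eGraph (IsEmbedding.subtypeVal.comp IsEmbedding.subtypeVal)
    hH.range_coe_ne_tip

/-- The free end of the `k`-th tooth. -/
def toothEnd (hH : IsCombSeq H) (k : ℕ) : combSet H :=
  ⟨(0, H (k + 1)), hH.tooth_mem_combSet (left_mem_Icc.2 (hH.pos _).le)⟩

theorem toothEnd_injective (hH : IsCombSeq H) : Function.Injective hH.toothEnd := fun _ _ h =>
  Nat.succ_injective (hH.anti.injective (congrArg (fun x : combSet H => x.1.2) h))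

theorem tendsto_toothEnd (hH : IsCombSeq H) :
    Filter.Tendsto hH.toothEnd Filter.atTop (𝓝 hH.tip) := by
  rw [tendsto_subtype_rng]
  exact tendsto_const_nhds.prodMk_nhds (hH.lim.comp (Filter.tendsto_add_atTop_nat 1))

theorem isEndPoint_toothEnd (hH : IsCombSeq H) (k : ℕ) : IsEndPoint (hH.toothEnd k) := by
  refine isEndPoint_of_isPreconnected_inter_ball
    ((hH.eventually_combSet_inter_ball_tooth (hH.pos (k + 1))).mono fun ε hε => ?_).frequently
  have hball : (combSet H ∩ Metric.ball (hH.toothEnd k : ℝ × ℝ) ε) \ {(hH.toothEnd k : ℝ × ℝ)} =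
      (fun t => (t, H (k + 1))) '' (Ioi 0 ∩ Ioo (0 - ε) (0 + ε)) := by
    have hinj : Function.Injective fun t : ℝ => (t, H (k + 1)) := fun _ _ h => (Prod.mk.inj h).1
    rw [toothEnd, hε, ← image_singleton (f := fun t : ℝ => (t, H (k + 1))), ← image_sdiff hinj,
      inter_sdiff_right_comm, Ici_sdiff_left]
  exact hball ▸ (ordConnected_Ioi.inter ordConnected_Ioo).isPreconnected.image _ (by fun_prop)

theorem infinite_isEndPoint_inter (hH : IsCombSeq H) {U : Set (combSet H)} (hU : U ∈ 𝓝 hH.tip) :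
    ({x | IsEndPoint x} ∩ U).Infinite := by
  obtain ⟨N, hN⟩ := Filter.eventually_atTop.1 (hH.tendsto_toothEnd hU)
  exact infinite_of_injective_forall_mem (hH.toothEnd_injective.comp (add_left_injective N))
    fun k => ⟨hH.isEndPoint_toothEnd _, hN _ (Nat.le_add_left _ _)⟩

theorem not_homeomorphicToEGraph (hH : IsCombSeq H) :
    ¬ HomeomorphicToEGraph.{u} (combSet H) := fun h => by
  obtain ⟨U, hU, hfin⟩ := h.exists_nhds_finite_isEndPoint hH.tip
  exact hH.infinite_isEndPoint_inter hU hfin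

theorem eq_tip_of_homeomorphicToEGraph (hH : IsCombSeq H) {p : combSet H}
    (h : HomeomorphicToEGraph.{u} {x : combSet H // x ≠ p}) : p = hH.tip := by
  by_contra hp
  obtain ⟨U, hU, hfin⟩ := h.exists_nhds_finite_isEndPoint ⟨hH.tip, Ne.symm hp⟩
  have hopen : IsOpenEmbedding (Subtype.val : {x : combSet H // x ≠ p} → combSet H) :=
    isOpen_compl_singleton.isOpenEmbedding_subtypeVal
  refine hH.infinite_isEndPoint_inter (hopen.image_mem_nhds.2 hU)
    ((hfin.image Subtype.val).subset ?_)
  rintro _ ⟨hend, y, hy, rfl⟩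
  exact ⟨y, ⟨.of_isOpenEmbedding hopen hend, hy⟩, rfl⟩

theorem noncompactSpace (hH : IsCombSeq H) : NoncompactSpace {x : combSet H // x ≠ hH.tip} := by
  refine not_compactSpace_iff.1 fun h => ?_
  have hclosed : IsClosed {x : combSet H | x ≠ hH.tip} := (isCompact_iff_compactSpace.2 h).isClosed
  exact hclosed.mem_of_tendsto hH.tendsto_toothEnd
    (.of_forall fun k => hH.ne_tip_iff.2 (hH.pos (k + 1))) rfl

theorem exists_onePoint_homeomorph (hH : IsCombSeq H) :
    ∃ ψ : OnePoint {x : combSet H // x ≠ hH.tip} ≃ₜ combSet H,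
      ψ OnePoint.infty = hH.tip ∧ ∀ x : {x : combSet H // x ≠ hH.tip}, ψ (x : OnePoint _) = x := by
  have := hH.noncompactSpace
  have := isCompact_iff_compactSpace.1 hH.isCompact_combSet
  have hrange : range (Subtype.val : {x : combSet H // x ≠ hH.tip} → combSet H) = {hH.tip}ᶜ :=
    Subtype.range_coe
  exact ⟨OnePoint.equivOfIsEmbeddingOfRangeEq hH.tip Subtype.val IsEmbedding.subtypeVal hrange,
    OnePoint.equivOfIsEmbeddingOfRangeEq_apply_infty _ _ _ _,
    OnePoint.equivOfIsEmbeddingOfRangeEq_apply_coe _ _ _ _⟩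

end IsCombSeq

open Real

section Smoothness

open Polynomial

/-- The functions `e^{-s²/2} (P(s) sin s + Q(s) cos s)` of `s = 1/x`, extended by `0`. This class
is closed under differentiation. -/
noncomputable def flatOsc (P Q : ℝ[X]) (x : ℝ) : ℝ :=
  if x = 0 then 0 else exp (-(x⁻¹ ^ 2 / 2)) * (P.eval x⁻¹ * sin x⁻¹ + Q.eval x⁻¹ * cos x⁻¹)

theorem flatOsc_zero (P Q : ℝ[X]) : flatOsc P Q 0 = 0 := if_pos rfl

theorem flatOsc_of_ne_zero (P Q : ℝ[X]) {x : ℝ} (hx : x ≠ 0) : flatOsc P Q x =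
    exp (-(x⁻¹ ^ 2 / 2)) * (P.eval x⁻¹ * sin x⁻¹ + Q.eval x⁻¹ * cos x⁻¹) := if_neg hx

theorem tendsto_exp_neg_sq_mul_eval_cobounded (P : ℝ[X]) :
    Filter.Tendsto (fun s => exp (-(s ^ 2 / 2)) * P.eval s) (Bornology.cobounded ℝ) (𝓝 0) := by
  induction P using Polynomial.induction_on' with
  | add p q hp hq => simpa only [eval_add, mul_add, add_zero] using hp.add hq
  | monomial n a =>
    have h := (tendsto_rpow_abs_mul_exp_neg_mul_sq_cocompact (a := 1 / 2) (by norm_num) n).const_mul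
      |a|
    rw [← Metric.cobounded_eq_cocompact, mul_zero] at h
    refine tendsto_zero_iff_norm_tendsto_zero.2 (h.congr fun s => ?_)
    have hexp : -(s ^ 2 / 2) = -(1 / 2) * s ^ 2 := by ring
    rw [eval_monomial, norm_mul, norm_mul, norm_pow, norm_eq_abs, norm_eq_abs, norm_eq_abs,
      abs_exp, rpow_natCast, hexp]
    ring

theorem tendsto_flatOsc (P Q : ℝ[X]) : Filter.Tendsto (flatOsc P Q) (𝓝[≠] 0) (𝓝 0) := by
  have hlim (R : ℝ[X]) :=
    ((tendsto_exp_neg_sq_mul_eval_cobounded R).comp Filter.tendsto_inv₀_nhdsNE_zero).norm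
  have hadd := (hlim P).add (hlim Q)
  rw [norm_zero, add_zero] at hadd
  refine squeeze_zero_norm' ?_ hadd
  filter_upwards [self_mem_nhdsWithin] with x hx
  rw [flatOsc_of_ne_zero P Q hx, mul_add, ← mul_assoc, ← mul_assoc]
  refine (norm_add_le _ _).trans (add_le_add ?_ ?_) <;> rw [norm_mul]
  · exact mul_le_of_le_one_right (norm_nonneg _) (abs_sin_le_one _)
  · exact mul_le_of_le_one_right (norm_nonneg _) (abs_cos_le_one _)

theorem hasDerivAt_flatOsc_zero (P Q : ℝ[X]) : HasDerivAt (flatOsc P Q) 0 0 := by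
  rw [hasDerivAt_iff_tendsto_slope]
  refine (tendsto_flatOsc (X * P) (X * Q)).congr' ?_
  filter_upwards [self_mem_nhdsWithin] with y hy
  rw [slope_def_field, flatOsc_zero, flatOsc_of_ne_zero _ _ hy, flatOsc_of_ne_zero _ _ hy,
    eval_mul, eval_mul, eval_X]
  ring

theorem hasDerivAt_flatOsc_of_ne_zero (P Q : ℝ[X]) {x : ℝ} (hx : x ≠ 0) :
    HasDerivAt (flatOsc P Q) (flatOsc (-X ^ 2 * (derivative P - Q - X * P))
      (-X ^ 2 * (derivative Q + P - X * Q)) x) x := by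
  have hinv := hasDerivAt_inv hx
  have hexp := (((hinv.fun_pow 2).div_const 2).fun_neg).exp
  have hsin := ((P.hasDerivAt x⁻¹).comp x hinv).mul hinv.sin
  have hcos := ((Q.hasDerivAt x⁻¹).comp x hinv).mul hinv.cos
  refine ((hexp.mul (hsin.add hcos)).congr_deriv ?_).congr_of_eventuallyEq ?_
  · rw [flatOsc_of_ne_zero _ _ hx]
    simp only [eval_mul, eval_sub, eval_add, eval_neg, eval_pow, eval_X, Function.comp_apply,
      Pi.mul_apply, Pi.add_apply, ← inv_pow]
    push_cast
    ring
  · filter_upwards [isOpen_compl_singleton.mem_nhds hx] with y hy using flatOsc_of_ne_zero P Q hy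

theorem hasDerivAt_flatOsc (P Q : ℝ[X]) (x : ℝ) :
    HasDerivAt (flatOsc P Q) (flatOsc (-X ^ 2 * (derivative P - Q - X * P))
      (-X ^ 2 * (derivative Q + P - X * Q)) x) x := by
  rcases eq_or_ne x 0 with rfl | hx
  · exact (flatOsc_zero _ _).symm ▸ hasDerivAt_flatOsc_zero P Q
  · exact hasDerivAt_flatOsc_of_ne_zero P Q hx

theorem contDiff_flatOsc (P Q : ℝ[X]) : ContDiff ℝ ∞ (flatOsc P Q) := by
  refine contDiff_infty.2 fun n => ?_
  induction n generalizing P Q with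
  | zero =>
    exact contDiff_zero.2 (continuous_iff_continuousAt.2 fun x =>
      (hasDerivAt_flatOsc P Q x).continuousAt)
  | succ n ih =>
    have hderiv := funext fun x => (hasDerivAt_flatOsc P Q x).deriv
    exact contDiff_succ_iff_deriv.2 ⟨fun x => (hasDerivAt_flatOsc P Q x).differentiableAt,
      fun h => absurd h (WithTop.natCast_ne_top n), hderiv ▸ ih _ _⟩

theorem c₀_eq_mul_flatOsc_sq : c₀ = fun x => x * flatOsc 1 0 x ^ 2 := by
  funext x
  rcases eq_or_ne x 0 with rfl | hx
  · simp [c₀]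
  · have hexp : exp (-(1 / x ^ 2)) = exp (-(x⁻¹ ^ 2 / 2)) ^ 2 := by
      rw [← exp_nat_mul]
      congr 1
      push_cast
      ring
    rw [flatOsc_of_ne_zero _ _ hx, c₀, hexp, eval_one, eval_zero, one_div]
    ring

theorem contDiff_c₀ : ContDiff ℝ ∞ c₀ :=
  c₀_eq_mul_flatOsc_sq ▸ contDiff_id.mul ((contDiff_flatOsc 1 0).pow 2)

theorem hasDerivAt_c₀_zero : HasDerivAt c₀ 0 0 := by
  rw [c₀_eq_mul_flatOsc_sq]
  exact ((hasDerivAt_id 0).mul ((hasDerivAt_flatOsc_zero 1 0).pow 2)).congr_deriv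
    (by simp [flatOsc_zero])

end Smoothness

theorem differentiable_c₀ : Differentiable ℝ c₀ := contDiff_c₀.differentiable (by simp)

theorem hasDerivAt_c₀ {x : ℝ} (hx : x ≠ 0) : HasDerivAt c₀ (exp (-(1 / x ^ 2)) * sin (1 / x) *
    ((2 / x ^ 2 + 1) * sin (1 / x) - 2 / x * cos (1 / x))) x := by
  have hinv : HasDerivAt (fun x : ℝ => 1 / x) (-(1 / x ^ 2)) x := by
    simpa [one_div] using hasDerivAt_inv hx
  have hexp : HasDerivAt (fun x : ℝ => exp (-(1 / x ^ 2)))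
      (exp (-(1 / x ^ 2)) * (2 / x ^ 3)) x := by
    simp only [one_div]
    refine (((hasDerivAt_pow 2 x).fun_inv (pow_ne_zero 2 hx)).fun_neg).exp.congr_deriv ?_
    push_cast
    field_simp
  refine ((hexp.mul (hasDerivAt_id x)).mul (hinv.sin.pow 2)).congr_deriv ?_
  simp only [Pi.pow_apply, Pi.mul_apply, id]
  push_cast
  field_simp
  ring

theorem analyticAt_c₀ {x : ℝ} (hx : x ≠ 0) : AnalyticAt ℝ c₀ x := by
  have hexp : AnalyticAt ℝ (fun x : ℝ => exp (-(1 / x ^ 2))) x :=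
    analyticAt_rexp.fun_comp
      (analyticAt_const.fun_div (analyticAt_id.pow 2) (pow_ne_zero 2 hx)).neg
  have hsin : AnalyticAt ℝ (fun x : ℝ => sin (1 / x)) x :=
    analyticAt_sin.fun_comp (analyticAt_const.fun_div analyticAt_id hx)
  exact (hexp.mul analyticAt_id).mul (hsin.pow 2)

theorem c₀_zero : c₀ 0 = 0 := by simp [c₀]

theorem c₀_nonneg {x : ℝ} (hx : 0 ≤ x) : 0 ≤ c₀ x := by
  unfold c₀
  positivity

theorem c₀_nonpos {x : ℝ} (hx : x ≤ 0) : c₀ x ≤ 0 :=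
  mul_nonpos_of_nonpos_of_nonneg (mul_nonpos_of_nonneg_of_nonpos (exp_pos _).le hx) (sq_nonneg _)

theorem c₀_le_exp_mul {x : ℝ} (hx : 0 ≤ x) : c₀ x ≤ exp (-(1 / x ^ 2)) * x :=
  mul_le_of_le_one_right (mul_nonneg (exp_pos _).le hx) (sin_sq_le_one _)

theorem c₀_le_self {x : ℝ} (hx : 0 ≤ x) : c₀ x ≤ x :=
  (c₀_le_exp_mul hx).trans (mul_le_of_le_one_left hx
    (exp_le_one_iff.2 (neg_nonpos.2 (by positivity))))

theorem exp_neg_one_div_le {t : ℝ} (ht : 0 < t) : exp (-(1 / t)) ≤ t / (t + 1) := by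
  have h := add_one_le_exp (1 / t)
  calc exp (-(1 / t)) = (exp (1 / t))⁻¹ := exp_neg _
    _ ≤ (1 / t + 1)⁻¹ := inv_anti₀ (by positivity) h
    _ = t / (t + 1) := by field_simp; ring

theorem c₀_le_half {x : ℝ} (hx : 0 ≤ x) (hx1 : x ≤ 1 / π) : c₀ x ≤ 1 / (2 * π) := by
  rcases hx.eq_or_lt with rfl | h0
  · rw [c₀_zero]
    positivity
  have hsq : x ^ 2 ≤ 1 := pow_le_one₀ hx
    (hx1.trans ((div_le_one pi_pos).2 (by linarith [pi_gt_three])))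
  have hexp : exp (-(1 / x ^ 2)) ≤ 1 / 2 :=
    (exp_neg_one_div_le (by positivity)).trans (by rw [div_le_iff₀ (by positivity)]; linarith)
  calc c₀ x ≤ exp (-(1 / x ^ 2)) * x := c₀_le_exp_mul hx
    _ ≤ 1 / 2 * (1 / π) := by gcongr
    _ = 1 / (2 * π) := by ring

theorem sin_sq_lt_mul_pi_sub {s : ℝ} (hs : s ∈ Ioo 0 π) : sin s ^ 2 < s * (π - s) := by
  have hpos : 0 < sin s := sin_pos_of_mem_Ioo hs
  have hsymm : sin s < π - s := sin_pi_sub s ▸ sin_lt (sub_pos.2 hs.2)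
  rw [sq]
  exact mul_lt_mul'' (sin_lt hs.1) hsymm hpos.le hpos.le

theorem c₀_lt_of_inv_pi_lt {x : ℝ} (hx : 1 / π < x) : c₀ x < π * x * (x - 1 / π) := by
  have hx0 : 0 < x := lt_trans (by positivity) hx
  have hs : 1 / x ∈ Ioo 0 π := ⟨by positivity, (one_div_lt pi_pos hx0).1 hx⟩
  have hexp : exp (-(1 / x ^ 2)) ≤ x ^ 2 :=
    (exp_neg_one_div_le (by positivity)).trans (div_le_self (by positivity) (by nlinarith))
  calc c₀ x < exp (-(1 / x ^ 2)) * x * (1 / x * (π - 1 / x)) :=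
        mul_lt_mul_of_pos_left (sin_sq_lt_mul_pi_sub hs) (by positivity)
    _ ≤ x ^ 2 * x * (1 / x * (π - 1 / x)) := by
        have := sub_pos.2 hs.2
        gcongr
    _ = π * x * (x - 1 / π) := by field_simp

/-- The positive zeros of `c₀`, in decreasing order. -/
noncomputable def zeroPt (k : ℕ) : ℝ := 1 / ((k + 1) * π)

theorem zeroPt_pos (k : ℕ) : 0 < zeroPt k := by
  unfold zeroPt
  positivity

theorem strictAnti_zeroPt : StrictAnti zeroPt := fun j k hjk => by
  have h : (j : ℝ) < k := by exact_mod_cast hjk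
  unfold zeroPt
  gcongr

theorem zeroPt_zero : zeroPt 0 = 1 / π := by simp [zeroPt]

theorem zeroPt_le (k : ℕ) : zeroPt k ≤ 1 / π :=
  zeroPt_zero ▸ strictAnti_zeroPt.antitone (Nat.zero_le k)

theorem tendsto_zeroPt : Filter.Tendsto zeroPt Filter.atTop (𝓝 0) := by
  have h := (tendsto_one_div_add_atTop_nhds_zero_nat (𝕜 := ℝ)).mul_const (1 / π)
  rw [zero_mul] at h
  refine h.congr fun k => ?_
  rw [zeroPt, one_div_mul_one_div]

theorem isCombSeq_zeroPt : IsCombSeq zeroPt := ⟨strictAnti_zeroPt, zeroPt_pos, tendsto_zeroPt⟩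

theorem sin_one_div_zeroPt (k : ℕ) : sin (1 / zeroPt k) = 0 := by
  rw [zeroPt, one_div_one_div]
  exact_mod_cast sin_nat_mul_pi (k + 1)

theorem c₀_zeroPt (k : ℕ) : c₀ (zeroPt k) = 0 := by
  rw [c₀, sin_one_div_zeroPt, zero_pow two_ne_zero, mul_zero]

theorem deriv_c₀_zeroPt (k : ℕ) : deriv c₀ (zeroPt k) = 0 := by
  rw [(hasDerivAt_c₀ (zeroPt_pos k).ne').deriv, sin_one_div_zeroPt, mul_zero, zero_mul]

theorem deriv_c₀_eq_zero_iff {x : ℝ} (hx : x ≠ 0) (hsin : sin (1 / x) ≠ 0) :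
    deriv c₀ x = 0 ↔ (2 * (1 / x) ^ 2 + 1) * sin (1 / x) = 2 * (1 / x) * cos (1 / x) := by
  rw [(hasDerivAt_c₀ hx).deriv, mul_eq_zero_iff_left (mul_ne_zero (exp_ne_zero _) hsin),
    sub_eq_zero, one_div_pow, mul_one_div, mul_one_div]

theorem one_div_sub_mem_of_mem_Ioo {k : ℕ} {x : ℝ} (hx : x ∈ Ioo (zeroPt (k + 1)) (zeroPt k)) :
    1 / x - (k + 1) * π ∈ Ioo 0 π := by
  have hlower := one_div_lt_one_div_of_lt ((zeroPt_pos _).trans hx.1) hx.2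
  have hupper := one_div_lt_one_div_of_lt (zeroPt_pos _) hx.1
  rw [zeroPt, one_div_one_div] at hlower hupper
  push_cast at hupper
  constructor <;> linarith

theorem sin_mul_sin_pos {k : ℕ} {x y : ℝ} (hx : x ∈ Ioo (zeroPt (k + 1)) (zeroPt k))
    (hy : y ∈ Ioo (zeroPt (k + 1)) (zeroPt k)) : 0 < sin (1 / x) * sin (1 / y) := by
  have hsin (s : ℝ) : sin (s - (k + 1) * π) = (-1) ^ (k + 1) * sin s := by
    exact_mod_cast sin_sub_nat_mul_pi s (k + 1)
  have h := mul_pos (sin_pos_of_mem_Ioo (one_div_sub_mem_of_mem_Ioo hx))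
    (sin_pos_of_mem_Ioo (one_div_sub_mem_of_mem_Ioo hy))
  rwa [hsin, hsin, mul_mul_mul_comm, ← mul_pow, neg_one_mul, neg_neg, one_pow, one_mul] at h

theorem sin_one_div_ne_zero {k : ℕ} {x : ℝ} (hx : x ∈ Ioo (zeroPt (k + 1)) (zeroPt k)) :
    sin (1 / x) ≠ 0 :=
  left_ne_zero_of_mul (sin_mul_sin_pos hx hx).ne'

theorem c₀_pos_of_mem_Ioo {k : ℕ} {x : ℝ} (hx : x ∈ Ioo (zeroPt (k + 1)) (zeroPt k)) :
    0 < c₀ x :=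
  mul_pos (mul_pos (exp_pos _) ((zeroPt_pos _).trans hx.1)) (sq_pos_of_ne_zero
    (sin_one_div_ne_zero hx))

-- The equations say `cot s = s + 1 / (2 s)`: `cot` decreases, the right-hand side increases.
theorem not_lt_of_two_mul_sq_add_one_mul_sin_eq {r s : ℝ} (hr : 1 ≤ r) (hsr : s < r + π)
    (hsin : 0 < sin r * sin s) (h : (2 * r ^ 2 + 1) * sin r = 2 * r * cos r)
    (h' : (2 * s ^ 2 + 1) * sin s = 2 * s * cos s) : ¬ r < s := fun hlt => by
  have hsub : 0 < sin s * cos r - cos s * sin r := by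
    rw [← sin_sub]
    exact sin_pos_of_pos_of_lt_pi (by linarith) (by linarith)
  have hcombine : 2 * s * r * (sin s * cos r - cos s * sin r) =
      sin r * sin s * ((s - r) * (1 - 2 * s * r)) := by
    linear_combination (r * sin r) * h' - (s * sin s) * h
  have hneg : (s - r) * (1 - 2 * s * r) < 0 :=
    mul_neg_of_pos_of_neg (by linarith) (by nlinarith)
  have hprod : 0 < 2 * s * r := by nlinarith
  exact (mul_pos hprod hsub).not_ge (hcombine.trans_le (mul_neg_of_pos_of_neg hsin hneg).le)

theorem not_lt_of_deriv_c₀_eq_zero {k : ℕ} {x y : ℝ} (hx : x ∈ Ioo (zeroPt (k + 1)) (zeroPt k))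
    (hy : y ∈ Ioo (zeroPt (k + 1)) (zeroPt k)) (hdx : deriv c₀ x = 0) (hdy : deriv c₀ y = 0) :
    ¬ x < y := fun hxy => by
  have hx0 := (zeroPt_pos _).trans hx.1
  have hy0 := (zeroPt_pos _).trans hy.1
  have hx' := one_div_sub_mem_of_mem_Ioo hx
  have hy' := one_div_sub_mem_of_mem_Ioo hy
  have hk : 0 ≤ k * π := by positivity
  exact not_lt_of_two_mul_sq_add_one_mul_sin_eq (by linarith [hy'.1, pi_gt_three])
    (by linarith [hx'.2, hy'.1]) (sin_mul_sin_pos hy hx)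
    ((deriv_c₀_eq_zero_iff hy0.ne' (sin_one_div_ne_zero hy)).1 hdy)
    ((deriv_c₀_eq_zero_iff hx0.ne' (sin_one_div_ne_zero hx)).1 hdx)
    (one_div_lt_one_div_of_lt hx0 hxy)

theorem mem_Ioo_of_c₀_pos {k : ℕ} {x : ℝ} (hx : x ∈ Icc (zeroPt (k + 1)) (zeroPt k))
    (h : 0 < c₀ x) : x ∈ Ioo (zeroPt (k + 1)) (zeroPt k) :=
  ⟨hx.1.lt_of_ne fun h' => h.ne' (h' ▸ c₀_zeroPt _), hx.2.lt_of_ne fun h' =>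
    h.ne' (h' ▸ c₀_zeroPt _)⟩

theorem deriv_c₀_eq_zero_of_forall_le {k : ℕ} {x : ℝ} (hx : x ∈ Ioo (zeroPt (k + 1)) (zeroPt k))
    (h : ∀ y ∈ Icc (zeroPt (k + 1)) (zeroPt k), c₀ y ≤ c₀ x) : deriv c₀ x = 0 :=
  IsLocalMax.deriv_eq_zero (Filter.eventually_of_mem (Icc_mem_nhds hx.1 hx.2) h)

theorem exists_isMaxOn_c₀ (k : ℕ) : ∃ a ∈ Ioo (zeroPt (k + 1)) (zeroPt k),
    ∀ x ∈ Icc (zeroPt (k + 1)) (zeroPt k), c₀ x ≤ c₀ a := by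
  have hlt := strictAnti_zeroPt k.lt_succ_self
  obtain ⟨a, ha, hmax⟩ := isCompact_Icc.exists_isMaxOn (nonempty_Icc.2 hlt.le)
    contDiff_c₀.continuous.continuousOn
  obtain ⟨b, hb⟩ := exists_between hlt
  exact ⟨a, mem_Ioo_of_c₀_pos ha ((c₀_pos_of_mem_Ioo hb).trans_le (hmax (Ioo_subset_Icc_self hb))),
    fun _ hx => hmax hx⟩

/-- The point between two consecutive zeros at which `c₀` is maximal. -/
noncomputable def peak (k : ℕ) : ℝ := (exists_isMaxOn_c₀ k).choose

theorem peak_mem (k : ℕ) : peak k ∈ Ioo (zeroPt (k + 1)) (zeroPt k) :=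
  (exists_isMaxOn_c₀ k).choose_spec.1

theorem c₀_le_c₀_peak {k : ℕ} {x : ℝ} (hx : x ∈ Icc (zeroPt (k + 1)) (zeroPt k)) :
    c₀ x ≤ c₀ (peak k) :=
  (exists_isMaxOn_c₀ k).choose_spec.2 x hx

theorem deriv_c₀_peak (k : ℕ) : deriv c₀ (peak k) = 0 :=
  deriv_c₀_eq_zero_of_forall_le (peak_mem k) fun _ => c₀_le_c₀_peak

theorem eq_peak_of_deriv_c₀_eq_zero {k : ℕ} {x : ℝ} (hx : x ∈ Ioo (zeroPt (k + 1)) (zeroPt k))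
    (h : deriv c₀ x = 0) : x = peak k :=
  le_antisymm (not_lt.1 (not_lt_of_deriv_c₀_eq_zero (peak_mem k) hx (deriv_c₀_peak k) h))
    (not_lt.1 (not_lt_of_deriv_c₀_eq_zero hx (peak_mem k) h (deriv_c₀_peak k)))

theorem peak_pos (k : ℕ) : 0 < peak k := (zeroPt_pos _).trans (peak_mem k).1

theorem c₀_peak_pos (k : ℕ) : 0 < c₀ (peak k) := c₀_pos_of_mem_Ioo (peak_mem k)

theorem c₀_peak_le_zeroPt (k : ℕ) : c₀ (peak k) ≤ zeroPt k :=
  (c₀_le_self (peak_pos k).le).trans (peak_mem k).2.le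

theorem eq_peak_of_c₀_eq {k : ℕ} {x : ℝ} (hx : x ∈ Icc (zeroPt (k + 1)) (zeroPt k))
    (h : c₀ x = c₀ (peak k)) : x = peak k :=
  have hx' := mem_Ioo_of_c₀_pos hx (h ▸ c₀_peak_pos k)
  eq_peak_of_deriv_c₀_eq_zero hx'
    (deriv_c₀_eq_zero_of_forall_le hx' fun _ hy => h ▸ c₀_le_c₀_peak hy)

theorem c₀_one_div (s : ℝ) : c₀ (1 / s) = exp (-s ^ 2) * (1 / s) * sin s ^ 2 := by
  rw [c₀, one_div_one_div, one_div_pow, one_div_one_div]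

theorem c₀_one_div_lt_c₀_one_div_sub_pi {s : ℝ} (hs : π < s) (hsin : sin s ≠ 0) :
    c₀ (1 / s) < c₀ (1 / (s - π)) := by
  have hpos : 0 < s - π := sub_pos.2 hs
  have hlt : s - π < s := sub_lt_self s pi_pos
  rw [c₀_one_div, c₀_one_div, sin_sub_pi, neg_sq]
  refine mul_lt_mul_of_pos_right (mul_lt_mul'' ?_ (one_div_lt_one_div_of_lt hpos hlt)
    (exp_pos _).le (one_div_nonneg.2 (hpos.trans hlt).le)) (sq_pos_of_ne_zero hsin)
  gcongr

theorem strictAnti_c₀_peak : StrictAnti fun k => c₀ (peak k) := by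
  refine strictAnti_nat_of_succ_lt fun k => ?_
  set s := 1 / peak (k + 1) with hs
  have hmem := one_div_sub_mem_of_mem_Ioo (peak_mem (k + 1))
  rw [← hs] at hmem
  push_cast at hmem
  have hk : 0 ≤ k * π := by positivity
  have hshift : 1 / (s - π) ∈ Icc (zeroPt (k + 1)) (zeroPt k) := by
    unfold zeroPt
    push_cast
    constructor <;> refine one_div_le_one_div_of_le (by nlinarith [hmem.1, pi_pos]) ?_ <;>
      linarith [hmem.1, hmem.2]
  calc c₀ (peak (k + 1)) = c₀ (1 / s) := by rw [hs, one_div_one_div]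
    _ < c₀ (1 / (s - π)) := c₀_one_div_lt_c₀_one_div_sub_pi (by nlinarith [hmem.1, pi_pos])
        (sin_one_div_ne_zero (peak_mem (k + 1)))
    _ ≤ c₀ (peak k) := c₀_le_c₀_peak hshift

theorem tendsto_c₀_peak : Filter.Tendsto (fun k => c₀ (peak k)) Filter.atTop (𝓝 0) :=
  squeeze_zero (fun k => (c₀_peak_pos k).le) c₀_peak_le_zeroPt tendsto_zeroPt

theorem exists_eq_zeroPt_or_mem_Ioo {x : ℝ} (hx0 : 0 < x) (hx1 : x ≤ 1 / π) :
    (∃ k, x = zeroPt k) ∨ ∃ k, x ∈ Ioo (zeroPt (k + 1)) (zeroPt k) :=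
  isCombSeq_zeroPt.exists_eq_or_mem_Ioo hx0 (zeroPt_zero ▸ hx1)

theorem exists_eq_zeroPt_or_eq_peak {x : ℝ} (hx0 : 0 < x) (hx1 : x ≤ 1 / π) (h : deriv c₀ x = 0) :
    (∃ k, x = zeroPt k) ∨ ∃ k, x = peak k :=
  (exists_eq_zeroPt_or_mem_Ioo hx0 hx1).imp_right fun ⟨k, hk⟩ =>
    ⟨k, eq_peak_of_deriv_c₀_eq_zero hk h⟩

theorem c₀_lt_c₀_peak_of_ne {k : ℕ} {x : ℝ} (hx0 : 0 ≤ x) (hx : x ≤ zeroPt k) (hne : x ≠ peak k) :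
    c₀ x < c₀ (peak k) := by
  rcases hx0.eq_or_lt with rfl | hx0
  · exact c₀_zero.trans_lt (c₀_peak_pos k)
  rcases exists_eq_zeroPt_or_mem_Ioo hx0 (hx.trans (zeroPt_le k)) with ⟨j, rfl⟩ | ⟨j, hj⟩
  · exact (c₀_zeroPt j).trans_lt (c₀_peak_pos k)
  have hle := c₀_le_c₀_peak (Ioo_subset_Icc_self hj)
  have hkj : k ≤ j := Nat.lt_succ_iff.1 (strictAnti_zeroPt.lt_iff_gt.1 (hj.1.trans_le hx))
  rcases hkj.eq_or_lt with rfl | hkj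
  · exact hle.lt_of_ne fun h => hne (eq_peak_of_c₀_eq (Ioo_subset_Icc_self hj) h)
  · exact hle.trans_lt (strictAnti_c₀_peak hkj)

/-- The point of `[0, 1/π]` nearest to `x`. It makes the running maximum of `c₀` a function on the
whole line. -/
noncomputable def clampPi (x : ℝ) : ℝ := max 0 (min x (1 / π))

theorem clampPi_mem (x : ℝ) : clampPi x ∈ Icc 0 (1 / π) :=
  ⟨le_max_left _ _, max_le (by positivity) (min_le_right _ _)⟩

theorem clampPi_of_mem {x : ℝ} (hx : x ∈ Icc 0 (1 / π)) : clampPi x = x := by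
  rw [clampPi, min_eq_left hx.2, max_eq_right hx.1]

theorem monotone_clampPi : Monotone clampPi := fun x y h => by
  unfold clampPi
  gcongr

theorem continuous_clampPi : Continuous clampPi := by
  unfold clampPi
  fun_prop

/-- The running maximum of `c₀` over `[0, x]`, for `x` clamped to `[0, 1/π]`. Writing `[0, x]` as
`{s x | s ∈ [0, 1]}` makes its continuity an instance of `IsCompact.continuous_sSup`. -/
noncomputable def runMax (x : ℝ) : ℝ := sSup ((fun s => c₀ (s * clampPi x)) '' Icc 0 1)

theorem continuous_runMax : Continuous runMax := by
  refine isCompact_Icc.continuous_sSup (f := fun x s => c₀ (s * clampPi x)) ?_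
  have := continuous_clampPi
  have := contDiff_c₀.continuous
  simp only [Function.HasUncurry.uncurry, id]
  fun_prop

theorem isGreatest_runMax (x : ℝ) : IsGreatest (c₀ '' Icc 0 (clampPi x)) (runMax x) := by
  have himage : (fun s => c₀ (s * clampPi x)) '' Icc 0 1 = c₀ '' Icc 0 (clampPi x) := by
    rw [← image_image c₀ (fun s => s * clampPi x)]
    congr 1
    rcases (clampPi_mem x).1.eq_or_lt with h0 | h0
    · simp [← h0]
    · simp [image_mul_right_Icc zero_le_one h0.le]
  rw [← himage]
  refine IsCompact.isGreatest_sSup ?_ ((nonempty_Icc.2 zero_le_one).image _)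
  have := contDiff_c₀.continuous
  exact isCompact_Icc.image (by fun_prop)

theorem c₀_le_runMax {x y : ℝ} (hy : y ∈ Icc 0 (clampPi x)) : c₀ y ≤ runMax x :=
  (isGreatest_runMax x).2 (mem_image_of_mem _ hy)

theorem runMax_le_half (x : ℝ) : runMax x ≤ 1 / (2 * π) := by
  obtain ⟨m, hm, h⟩ := (isGreatest_runMax x).1
  exact h ▸ c₀_le_half hm.1 (hm.2.trans (clampPi_mem x).2)

theorem monotone_runMax : Monotone runMax := fun x y h => by
  obtain ⟨m, hm, hxm⟩ := (isGreatest_runMax x).1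
  exact hxm ▸ c₀_le_runMax ⟨hm.1, hm.2.trans (monotone_clampPi h)⟩

theorem runMax_of_nonpos {x : ℝ} (hx : x ≤ 0) : runMax x = 0 := by
  obtain ⟨m, hm, hxm⟩ := (isGreatest_runMax x).1
  have h0 : clampPi x = 0 := max_eq_left ((min_le_left _ _).trans hx)
  rw [h0] at hm
  rw [← hxm, le_antisymm hm.2 hm.1, c₀_zero]

theorem runMax_eq_c₀_peak {k : ℕ} {x : ℝ} (hx : x ∈ Icc (peak k) (zeroPt k)) :
    runMax x = c₀ (peak k) := by
  have hclamp : clampPi x = x :=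
    clampPi_of_mem ⟨(peak_pos k).le.trans hx.1, hx.2.trans (zeroPt_le k)⟩
  refine (isGreatest_runMax x).unique ⟨mem_image_of_mem _ ?_, ?_⟩ <;> rw [hclamp]
  · exact ⟨(peak_pos k).le, hx.1⟩
  · rintro _ ⟨y, hy, rfl⟩
    rcases eq_or_ne y (peak k) with rfl | hne
    · exact le_rfl
    · exact (c₀_lt_c₀_peak_of_ne hy.1 (hy.2.trans hx.2) hne).le

theorem runMax_zeroPt (k : ℕ) : runMax (zeroPt k) = c₀ (peak k) :=
  runMax_eq_c₀_peak ⟨(peak_mem k).2.le, le_rfl⟩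

theorem runMax_peak (k : ℕ) : runMax (peak k) = c₀ (peak k) :=
  runMax_eq_c₀_peak ⟨le_rfl, (peak_mem k).2.le⟩

theorem exists_peak_mem_Ioo_of_lt_c₀ {a b w t : ℝ} (ha : 0 ≤ a) (hb : b ≤ 1 / π) (ht : 0 ≤ t)
    (hat : c₀ a ≤ t) (hbt : c₀ b ≤ t) (hw : w ∈ Icc a b) (htw : t < c₀ w) :
    ∃ k, peak k ∈ Ioo a b ∧ ∀ x ∈ Icc a b, c₀ x ≤ c₀ (peak k) := by
  obtain ⟨m, hm, hmax⟩ := isCompact_Icc.exists_isMaxOn ⟨w, hw⟩ contDiff_c₀.continuous.continuousOn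
  have htm : t < c₀ m := htw.trans_le (hmax hw)
  have hmem : m ∈ Ioo a b :=
    ⟨hm.1.lt_of_ne fun h => htm.not_ge (h ▸ hat), hm.2.lt_of_ne fun h => htm.not_ge (h ▸ hbt)⟩
  have hderiv : deriv c₀ m = 0 :=
    IsLocalMax.deriv_eq_zero (Filter.eventually_of_mem (Icc_mem_nhds hmem.1 hmem.2) hmax)
  rcases exists_eq_zeroPt_or_eq_peak (ha.trans_lt hmem.1) (hm.2.trans hb) hderiv with
    ⟨k, rfl⟩ | ⟨k, rfl⟩
  · exact absurd (c₀_zeroPt k) (ht.trans_lt htm).ne'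
  · exact ⟨k, hmem, hmax⟩

theorem exists_runMax_eq {x t : ℝ} (ht : 0 ≤ t) (hx : c₀ (clampPi x) ≤ t) (h : t < runMax x) :
    ∃ k, runMax x = c₀ (peak k) := by
  obtain ⟨m, hm, hxm⟩ := (isGreatest_runMax x).1
  obtain ⟨k, hk, hmax⟩ := exists_peak_mem_Ioo_of_lt_c₀ le_rfl (clampPi_mem x).2 ht
    (c₀_zero.trans_le ht) hx hm (hxm ▸ h)
  exact ⟨k, (isGreatest_runMax x).unique
    ⟨mem_image_of_mem _ (Ioo_subset_Icc_self hk), forall_mem_image.2 hmax⟩⟩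

theorem max_runMax_lt_runMax {x y w t : ℝ} (ht : 0 ≤ t) (hx : c₀ (clampPi x) ≤ t)
    (hy : c₀ (clampPi y) ≤ t) (hw : w ∈ Icc (clampPi x) (clampPi y)) (htw : t < c₀ w) :
    max t (runMax x) < runMax y := by
  obtain ⟨k, hk, hmax⟩ :=
    exists_peak_mem_Ioo_of_lt_c₀ (clampPi_mem x).1 (clampPi_mem y).2 ht hx hy hw htw
  have hpeak : c₀ (peak k) ≤ runMax y := c₀_le_runMax ⟨(peak_pos k).le, hk.2.le⟩
  obtain ⟨n, hn, hxn⟩ := (isGreatest_runMax x).1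
  have hnk : n < peak k := hn.2.trans_lt hk.1
  exact max_lt (htw.trans_le ((hmax w hw).trans hpeak)) (hxn ▸
    (c₀_lt_c₀_peak_of_ne hn.1 (hnk.trans (peak_mem k).2).le hnk.ne).trans_le hpeak)

theorem max_runMax_eq_iff {x y t : ℝ} (ht : 0 ≤ t) (hxy : x ≤ y) (hx : c₀ (clampPi x) ≤ t)
    (hy : c₀ (clampPi y) ≤ t) :
    max t (runMax x) = max t (runMax y) ↔ ∀ w ∈ Icc (clampPi x) (clampPi y), c₀ w ≤ t := by
  refine ⟨fun h w hw => not_lt.1 fun htw => ?_, fun h => ?_⟩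
  · exact ((max_runMax_lt_runMax ht hx hy hw htw).trans_le (le_max_right _ _)).ne h
  refine le_antisymm (max_le_max le_rfl (monotone_runMax hxy)) (max_le (le_max_left _ _) ?_)
  obtain ⟨n, hn, hyn⟩ := (isGreatest_runMax y).1
  rw [← hyn]
  rcases le_total n (clampPi x) with hnx | hxn
  · exact le_max_of_le_right (c₀_le_runMax ⟨hn.1, hnx⟩)
  · exact le_max_of_le_left (h n ⟨hxn, hn.2⟩)

theorem exists_continuousLinearEquiv_eq_prod {E F G : Type*} [NormedAddCommGroup E]
    [NormedSpace ℝ E] [FiniteDimensional ℝ E] [NormedAddCommGroup F] [NormedSpace ℝ F]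
    [FiniteDimensional ℝ F] [NormedAddCommGroup G] [NormedSpace ℝ G] [FiniteDimensional ℝ G]
    (hrank : Module.finrank ℝ E = Module.finrank ℝ G + Module.finrank ℝ F) (L : E →L[ℝ] F)
    (hL : Function.Surjective L) :
    ∃ (A : E →L[ℝ] G) (e : E ≃L[ℝ] G × F), (e : E →L[ℝ] G × F) = A.prod L := by
  have hker : Module.finrank ℝ L.ker = Module.finrank ℝ G := by
    have h := LinearMap.finrank_range_add_finrank_ker L.toLinearMap
    rw [LinearMap.range_eq_top.2 hL, finrank_top] at h
    omega
  have := FiniteDimensional.complete ℝ E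
  have := FiniteDimensional.complete ℝ F
  obtain ⟨g, hg⟩ := L.ker_closedComplemented_of_finiteDimensional_range
  let f := ContinuousLinearEquiv.ofFinrankEq hker
  let e := ContinuousLinearMap.equivProdOfSurjectiveOfIsCompl g L
    (LinearMap.range_eq_top.2 fun x => ⟨x, hg x⟩) (LinearMap.range_eq_top.2 hL)
    (LinearMap.isCompl_of_proj hg).symm
  exact ⟨(f : L.ker →L[ℝ] G) ∘L g, e.trans (f.prodCongr (.refl ℝ F)), rfl⟩

theorem exists_chart_of_surjective_fderiv {d k n : ℕ} (hn : n = d + k)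
    {f : EuclideanSpace ℝ (Fin n) → EuclideanSpace ℝ (Fin k)} (hf : ContDiff ℝ ∞ f)
    {x : EuclideanSpace ℝ (Fin n)} (hsurj : Function.Surjective (fderiv ℝ f x)) :
    ∃ (φ : OpenPartialHomeomorph (EuclideanSpace ℝ (Fin n))
        (EuclideanSpace ℝ (Fin d) × EuclideanSpace ℝ (Fin k)))
      (e : EuclideanSpace ℝ (Fin n) ≃L[ℝ] EuclideanSpace ℝ (Fin d) × EuclideanSpace ℝ (Fin k)),
      x ∈ φ.source ∧ ContDiffOn ℝ ∞ φ φ.source ∧ ContDiffOn ℝ ∞ φ.symm φ.target ∧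
        (∀ y, (φ y).2 = f y) ∧ HasFDerivAt φ (e : EuclideanSpace ℝ (Fin n) →L[ℝ] _) x ∧
        ∀ v, (e v).2 = fderiv ℝ f x v := by
  obtain ⟨A, e, he⟩ := exists_continuousLinearEquiv_eq_prod (G := EuclideanSpace ℝ (Fin d))
    (by simpa only [finrank_euclideanSpace_fin] using hn) (fderiv ℝ f x) hsurj
  let g := fun y => (A y, f y)
  have hg : ContDiff ℝ ∞ g := A.contDiff.prodMk hf
  have hgx : HasFDerivAt g (e : EuclideanSpace ℝ (Fin n) →L[ℝ] _) x :=
    he ▸ A.hasFDerivAt.prodMk (hf.differentiable (by simp) x).hasFDerivAt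
  -- The inverse is smooth only where the derivative of `g` is invertible.
  let V := {y | fderiv ℝ g y ∈ range ((↑) : (EuclideanSpace ℝ (Fin n) ≃L[ℝ]
    EuclideanSpace ℝ (Fin d) × EuclideanSpace ℝ (Fin k)) → _)}
  have hV : IsOpen V := ContinuousLinearEquiv.isOpen.preimage (hg.continuous_fderiv (by simp))
  let φ := (hg.contDiffAt.toOpenPartialHomeomorph g hgx (by simp)).restrOpen V hV
  have hsource : x ∈ φ.source :=
    ⟨hg.contDiffAt.mem_toOpenPartialHomeomorph_source hgx (by simp), e, hgx.fderiv.symm⟩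
  have hsymm : ContDiffOn ℝ ∞ φ.symm φ.target := fun z hz => by
    obtain ⟨e', he'⟩ := (φ.map_target hz).2
    refine (φ.contDiffAt_symm (f₀' := e') hz ?_ hg.contDiffAt).contDiffWithinAt
    rw [he']
    exact (hg.differentiable (by simp) _).hasFDerivAt
  exact ⟨φ, e, hsource, hg.contDiffOn, hsymm, fun _ => rfl, hgx,
    fun v => congrArg Prod.snd (DFunLike.congr_fun he v)⟩

theorem isSmoothSubmanifold_preimage_zero {d k n : ℕ} (hn : n = d + k)
    {f : EuclideanSpace ℝ (Fin n) → EuclideanSpace ℝ (Fin k)} (hf : ContDiff ℝ ∞ f)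
    (hsurj : ∀ x, f x = 0 → Function.Surjective (fderiv ℝ f x)) :
    IsSmoothSubmanifold d (f ⁻¹' {0}) := by
  refine ⟨k, hn, fun x hx => ?_⟩
  obtain ⟨φ, -, hsource, hφ, hsymm, hsnd, -⟩ := exists_chart_of_surjective_fderiv hn hf (hsurj x hx)
  exact ⟨φ, hsource, hφ, hsymm, fun y _ => by rw [hsnd]; rfl⟩

theorem fderiv_eq_zero_of_mem_tangentVectors {n : ℕ} {F : Type*} [NormedAddCommGroup F]
    [NormedSpace ℝ F] {f : EuclideanSpace ℝ (Fin n) → F} {x v : EuclideanSpace ℝ (Fin n)} {c : F}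
    (hf : DifferentiableAt ℝ f x) (hv : v ∈ tangentVectors (f ⁻¹' {c}) x) :
    fderiv ℝ f x v = 0 := by
  obtain ⟨γ, -, hmem, rfl, hγ⟩ := hv
  exact (hf.hasFDerivAt.comp_hasDerivAt 0 hγ).unique
    ((hasDerivAt_const (0 : ℝ) c).congr_of_eventuallyEq hmem)

theorem mem_tangentVectors_preimage_zero_iff {d k n : ℕ} (hn : n = d + k)
    {f : EuclideanSpace ℝ (Fin n) → EuclideanSpace ℝ (Fin k)} (hf : ContDiff ℝ ∞ f)
    {x v : EuclideanSpace ℝ (Fin n)} (hx : f x = 0) (hsurj : Function.Surjective (fderiv ℝ f x)) :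
    v ∈ tangentVectors (f ⁻¹' {0}) x ↔ fderiv ℝ f x v = 0 := by
  refine ⟨fderiv_eq_zero_of_mem_tangentVectors (hf.differentiable (by simp) x), fun hv => ?_⟩
  obtain ⟨φ, e, hsource, -, hsymm, hsnd, hφx, he⟩ := exists_chart_of_surjective_fderiv hn hf hsurj
  have hφ0 : φ x + (0 : ℝ) • e v = φ x := by rw [zero_smul, add_zero]
  have hline : HasDerivAt (fun s : ℝ => φ x + s • e v) (e v) 0 := by
    simpa using ((hasDerivAt_id (0 : ℝ)).smul_const (e v)).const_add (φ x)
  have htarget : φ.target ∈ 𝓝 (φ x + (0 : ℝ) • e v) :=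
    φ.open_target.mem_nhds (by rw [hφ0]; exact φ.map_source hsource)
  have hsymmx : HasFDerivAt φ.symm (e.symm : _ →L[ℝ] EuclideanSpace ℝ (Fin n))
      (φ x + (0 : ℝ) • e v) :=
    φ.hasFDerivAt_symm (mem_of_mem_nhds htarget) (by rwa [hφ0, φ.left_inv hsource])
  refine ⟨fun s => φ.symm (φ x + s • e v), ?_, ?_, ?_, ?_⟩
  · exact (hsymm.contDiffAt htarget).comp 0 (by fun_prop)
  · filter_upwards [hline.continuousAt.preimage_mem_nhds htarget] with s hs
    have hsnd_s := hsnd (φ.symm (φ x + s • e v))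
    rw [φ.right_inv hs, Prod.snd_add, Prod.smul_snd, he, hv, hsnd, hx, smul_zero, add_zero]
      at hsnd_s
    exact hsnd_s.symm
  · change φ.symm (φ x + (0 : ℝ) • e v) = x
    rw [hφ0, φ.left_inv hsource]
  · exact (hsymmx.comp_hasDerivAt 0 hline).congr_deriv (e.symm_apply_apply v)

theorem contDiff_eMap (p₁ p₂ r₁ r₂ r₁₂ : ℝ) (m₁ m₂ : ℕ) :
    ContDiff ℝ ∞ (eMap p₁ p₂ r₁ r₂ r₁₂ m₁ m₂) := by
  have hc₀ := contDiff_c₀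
  refine contDiff_euclidean.2 fun i => ?_
  fin_cases i
  · change ContDiff ℝ ∞ fun x : EuclideanSpace ℝ (Fin (m₁ + m₂ + 2)) => x 0 - c₀ (x 1) -
      ∑ j : Fin m₁, x ⟨2 + j, _⟩ ^ 2
    fun_prop
  · change ContDiff ℝ ∞ fun x : EuclideanSpace ℝ (Fin (m₁ + m₂ + 2)) =>
      r₁₂ - ((x 0 - p₁) ^ 2 / r₁ + (x 1 - p₂) ^ 2 / r₂) - ∑ j : Fin m₂, x ⟨2 + m₁ + j, _⟩ ^ 2
    fun_prop

theorem analyticAt_eMap (p₁ p₂ r₁ r₂ r₁₂ : ℝ) {m₁ m₂ : ℕ}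
    {x : EuclideanSpace ℝ (Fin (m₁ + m₂ + 2))} (hx : x 1 ≠ 0) :
    AnalyticAt ℝ (eMap p₁ p₂ r₁ r₂ r₁₂ m₁ m₂) x := by
  have hproj (i : Fin (m₁ + m₂ + 2)) :
      AnalyticAt ℝ (fun x : EuclideanSpace ℝ (Fin (m₁ + m₂ + 2)) => x i) x :=
    (EuclideanSpace.proj (𝕜 := ℝ) i).analyticAt x
  have hc₀ : AnalyticAt ℝ (fun x : EuclideanSpace ℝ (Fin (m₁ + m₂ + 2)) => c₀ (x 1)) x :=
    AnalyticAt.fun_comp (g := c₀) (analyticAt_c₀ hx) (hproj 1)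
  have hsq (k : ℕ) (σ : Fin k → Fin (m₁ + m₂ + 2)) : AnalyticAt ℝ
      (fun x : EuclideanSpace ℝ (Fin (m₁ + m₂ + 2)) => ∑ j, x (σ j) ^ 2) x :=
    Finset.univ.analyticAt_fun_sum fun j _ => (hproj _).pow 2
  have hquad (i : Fin (m₁ + m₂ + 2)) (p r : ℝ) :
      AnalyticAt ℝ (fun x : EuclideanSpace ℝ (Fin (m₁ + m₂ + 2)) => (x i - p) ^ 2 / r) x := by
    simp only [div_eq_mul_inv]
    exact (((hproj i).sub analyticAt_const).pow 2).mul analyticAt_const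
  have hpi : AnalyticAt ℝ (fun x => (eMap p₁ p₂ r₁ r₂ r₁₂ m₁ m₂ x).ofLp) x := by
    refine analyticAt_pi_iff.2 fun i => ?_
    fin_cases i
    · exact ((hproj 0).sub hc₀).sub (hsq m₁ _)
    · exact (analyticAt_const.sub ((hquad 0 p₁ r₁).add (hquad 1 p₂ r₂))).sub (hsq m₂ _)
  exact ((EuclideanSpace.equiv (Fin 2) ℝ).symm.toContinuousLinearMap.analyticAt _).fun_comp hpi

theorem volume_setOf_apply_eq_zero {n : ℕ} (i : Fin n) :
    volume {x : EuclideanSpace ℝ (Fin n) | x i = 0} = 0 := by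
  refine Measure.addHaar_submodule volume
    (EuclideanSpace.proj (𝕜 := ℝ) i : EuclideanSpace ℝ (Fin n) →L[ℝ] ℝ).ker fun h => ?_
  have hmem : EuclideanSpace.single i (1 : ℝ) ∈
      (EuclideanSpace.proj (𝕜 := ℝ) i : EuclideanSpace ℝ (Fin n) →L[ℝ] ℝ).ker :=
    h ▸ Submodule.mem_top
  simp at hmem

section Coordinates

variable (m₁ m₂ : ℕ)

/-- The linear map splitting a point of `ℝ^{m₁+m₂+2}` into `(x₁, x₂, y, z)`. -/
def coordsLinearMap : EuclideanSpace ℝ (Fin (m₁ + m₂ + 2)) →ₗ[ℝ]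
    ℝ × ℝ × EuclideanSpace ℝ (Fin m₁) × EuclideanSpace ℝ (Fin m₂) where
  toFun x := (x 0, x 1, WithLp.toLp 2 fun j => x ⟨2 + j, by have := j.isLt; omega⟩,
    WithLp.toLp 2 fun j => x ⟨2 + m₁ + j, by have := j.isLt; omega⟩)
  map_add' _ _ := rfl
  map_smul' _ _ := rfl

theorem injective_coordsLinearMap : Function.Injective (coordsLinearMap m₁ m₂) := fun x y h => by
  have h0 : x 0 = y 0 := congrArg Prod.fst h
  have h1 : x 1 = y 1 := congrArg (fun q => q.2.1) h
  have hy := congrArg (fun q => q.2.2.1) h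
  have hz := congrArg (fun q => q.2.2.2) h
  ext ⟨i, hi⟩
  obtain rfl | rfl | ⟨j, rfl⟩ | ⟨j, rfl⟩ : i = 0 ∨ i = 1 ∨ (∃ j : Fin m₁, i = 2 + j) ∨
      ∃ j : Fin m₂, i = 2 + m₁ + j := by
    by_cases hlt : i < 2 + m₁
    · by_cases h2 : i < 2
      · omega
      · exact Or.inr (Or.inr (Or.inl ⟨⟨i - 2, by omega⟩, (Nat.add_sub_of_le (not_lt.1 h2)).symm⟩))
    · exact Or.inr (Or.inr (Or.inr ⟨⟨i - (2 + m₁), by omega⟩,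
        (Nat.add_sub_of_le (not_lt.1 hlt)).symm⟩))
  · exact h0
  · exact h1
  · exact congrArg (fun v : EuclideanSpace ℝ (Fin m₁) => v j) hy
  · exact congrArg (fun v : EuclideanSpace ℝ (Fin m₂) => v j) hz

/-- The coordinates `(x₁, x₂, y, z)` on `ℝ^{m₁+m₂+2}`, with `y` and `z` grouped into vectors. -/
noncomputable def coords : EuclideanSpace ℝ (Fin (m₁ + m₂ + 2)) ≃L[ℝ]
    ℝ × ℝ × EuclideanSpace ℝ (Fin m₁) × EuclideanSpace ℝ (Fin m₂) :=
  ((coordsLinearMap m₁ m₂).linearEquivOfInjective (injective_coordsLinearMap m₁ m₂) (by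
    simp only [Module.finrank_prod, Module.finrank_self, finrank_euclideanSpace_fin]
    omega)).toContinuousLinearEquiv

variable {m₁ m₂}

/-- The first component of `eMap` in the coordinates `(x₁, x₂, y, z)`. -/
noncomputable def leftFun
    (q : ℝ × ℝ × EuclideanSpace ℝ (Fin m₁) × EuclideanSpace ℝ (Fin m₂)) : ℝ :=
  q.1 - c₀ q.2.1 - ‖q.2.2.1‖ ^ 2

/-- The defining function of the disk whose boundary passes through the vertices `(0, 0)`,
`(0, 1/π)`, `(1/π, 0)` and `(1/π, 1/π)` of a square. -/
noncomputable def disk (t x : ℝ) : ℝ := t * (1 / π - t) + x * (1 / π - x)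

/-- The second component of `eMap` in the coordinates `(x₁, x₂, y, z)`, for the parameters chosen
in `oscMap`. -/
noncomputable def rightFun
    (q : ℝ × ℝ × EuclideanSpace ℝ (Fin m₁) × EuclideanSpace ℝ (Fin m₂)) : ℝ :=
  disk q.1 q.2.1 - ‖q.2.2.2‖ ^ 2

variable (m₁ m₂) in
/-- The map `eMap` for the parameters which make its second component a disk through the origin and
through the largest zero `1/π` of `c₀`. -/
noncomputable abbrev oscMap :
    EuclideanSpace ℝ (Fin (m₁ + m₂ + 2)) → EuclideanSpace ℝ (Fin 2) :=
  eMap (1 / (2 * π)) (1 / (2 * π)) 1 1 (1 / (2 * π ^ 2)) m₁ m₂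

variable (m₁ m₂) in
/-- The manifold of the theorem, the zero set of `oscMap`. -/
noncomputable abbrev oscManifold : Set (EuclideanSpace ℝ (Fin (m₁ + m₂ + 2))) :=
  zeroManifold (1 / (2 * π)) (1 / (2 * π)) 1 1 (1 / (2 * π ^ 2)) m₁ m₂

theorem disk_add_sq (t x : ℝ) :
    disk t x + (t - 1 / (2 * π)) ^ 2 + (x - 1 / (2 * π)) ^ 2 = 1 / (2 * π ^ 2) := by
  unfold disk
  field_simp
  ring

theorem oscMap_eq (x : EuclideanSpace ℝ (Fin (m₁ + m₂ + 2))) :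
    oscMap m₁ m₂ x = !₂[leftFun (coords m₁ m₂ x), rightFun (coords m₁ m₂ x)] := by
  have hdisk : disk (x 0) (x 1) = 1 / (2 * π ^ 2) -
      ((x 0 - 1 / (2 * π)) ^ 2 / 1 + (x 1 - 1 / (2 * π)) ^ 2 / 1) := by
    rw [← disk_add_sq (x 0) (x 1)]
    ring
  have hcoords : ((coords m₁ m₂ x).1, (coords m₁ m₂ x).2.1) = (x 0, x 1) := rfl
  obtain ⟨h0, h1⟩ := Prod.mk.inj hcoords
  rw [leftFun, rightFun, EuclideanSpace.real_norm_sq_eq, EuclideanSpace.real_norm_sq_eq, h0, h1,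
    hdisk]
  rfl

theorem mem_oscManifold {x : EuclideanSpace ℝ (Fin (m₁ + m₂ + 2))} : x ∈ oscManifold m₁ m₂ ↔
    leftFun (coords m₁ m₂ x) = 0 ∧ rightFun (coords m₁ m₂ x) = 0 := by
  change oscMap m₁ m₂ x = 0 ↔ _
  rw [oscMap_eq, PiLp.ext_iff, Fin.forall_fin_two]
  rfl

end Coordinates

/-- The projection of the zero set of `eMap` to the first two coordinates. -/
def region : Set (ℝ × ℝ) := {d | 0 ≤ d.1 - c₀ d.2 ∧ 0 ≤ disk d.1 d.2}

theorem disk_nonneg_of_abs_le {t x s w : ℝ} (h : 0 ≤ disk t x)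
    (hs : |s - 1 / (2 * π)| ≤ |t - 1 / (2 * π)|) (hw : |w - 1 / (2 * π)| ≤ |x - 1 / (2 * π)|) :
    0 ≤ disk s w := by
  linarith [disk_add_sq t x, disk_add_sq s w, sq_le_sq.2 hs, sq_le_sq.2 hw]

theorem disk_nonneg_of_mem_Icc {t x y w : ℝ} (hx : 0 ≤ disk t x) (hy : 0 ≤ disk t y)
    (hw : w ∈ Icc x y) : 0 ≤ disk t w :=
  (le_max_iff.1 (abs_le_max_abs_abs (sub_le_sub_right hw.1 _) (sub_le_sub_right hw.2 _))).elim
    (disk_nonneg_of_abs_le hx le_rfl) (disk_nonneg_of_abs_le hy le_rfl)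

theorem disk_nonneg_of_mem {t x : ℝ} (ht : t ∈ Icc 0 (1 / π)) (hx : x ∈ Icc 0 (1 / π)) :
    0 ≤ disk t x :=
  add_nonneg (mul_nonneg ht.1 (sub_nonneg.2 ht.2)) (mul_nonneg hx.1 (sub_nonneg.2 hx.2))

theorem c₀_lt_of_disk_nonneg {t x : ℝ} (hx : 1 / π < x) (h : 0 ≤ disk t x) : c₀ x < t := by
  have hpi : π * (1 / π) = 1 := mul_one_div_cancel pi_ne_zero
  have hle : x * (x - 1 / π) ≤ t * (1 / π) := by
    have : t * (1 / π) - x * (x - 1 / π) = disk t x + t ^ 2 := by unfold disk; ring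
    nlinarith [sq_nonneg t]
  calc c₀ x < π * x * (x - 1 / π) := c₀_lt_of_inv_pi_lt hx
    _ = π * (x * (x - 1 / π)) := mul_assoc _ _ _
    _ ≤ π * (t * (1 / π)) := mul_le_mul_of_nonneg_left hle pi_pos.le
    _ = t := by rw [mul_left_comm, hpi, mul_one]

theorem pos_of_disk_nonneg {t x : ℝ} (hx : x < 0) (h : 0 ≤ disk t x) : 0 < t := by
  have hpi : (0 : ℝ) < 1 / π := by positivity
  unfold disk at h
  by_contra ht
  nlinarith

-- Outside `0 ≤ x ≤ 1/π` the disk lies to the right of the graph of `c₀`.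
theorem mem_region_iff {t x : ℝ} :
    (t, x) ∈ region ↔ 0 ≤ disk t x ∧ 0 ≤ t ∧ c₀ (clampPi x) ≤ t := by
  change 0 ≤ t - c₀ x ∧ 0 ≤ disk t x ↔ _
  have hpi : (0 : ℝ) < 1 / π := by positivity
  rw [and_comm, sub_nonneg]
  refine and_congr_right fun hdisk => ?_
  rcases lt_or_ge x 0 with hx | hx
  · have ht := (pos_of_disk_nonneg hx hdisk).le
    have hclamp : clampPi x = 0 := max_eq_left ((min_le_left _ _).trans hx.le)
    rw [hclamp, c₀_zero]
    exact iff_of_true ((c₀_nonpos hx.le).trans ht) ⟨ht, ht⟩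
  rcases lt_or_ge (1 / π) x with hx1 | hx1
  · have ht := (c₀_lt_of_disk_nonneg hx1 hdisk).le
    have hclamp : clampPi x = 1 / π := by rw [clampPi, min_eq_right hx1.le, max_eq_right hpi.le]
    rw [hclamp, ← zeroPt_zero, c₀_zeroPt]
    exact iff_of_true ht ⟨(c₀_nonneg hx).trans ht, (c₀_nonneg hx).trans ht⟩
  · rw [clampPi_of_mem ⟨hx, hx1⟩]
    exact ⟨fun h => ⟨(c₀_nonneg hx).trans h, h⟩, And.right⟩

theorem one_div_two_mul_pi_mem_Icc : 1 / (2 * π) ∈ Icc 0 (1 / π) :=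
  ⟨by positivity, one_div_le_one_div_of_le pi_pos (by linarith [pi_pos])⟩

/-- The ordinates of the vertices on the spine of the comb: the largest abscissa of the disk,
followed by the values of `c₀` at its peaks. -/
noncomputable def combHeight : ℕ → ℝ
  | 0 => 1 / (2 * π) + √(1 / (2 * π ^ 2))
  | k + 1 => c₀ (peak k)

theorem c₀_peak_le_half (k : ℕ) : c₀ (peak k) ≤ 1 / (2 * π) :=
  c₀_le_half (peak_pos k).le ((peak_mem k).2.le.trans (zeroPt_le k))

theorem half_lt_combHeight_zero : 1 / (2 * π) < combHeight 0 :=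
  lt_add_of_pos_right _ (sqrt_pos.2 (by positivity))

theorem isCombSeq_combHeight : IsCombSeq combHeight where
  anti := by
    refine strictAnti_nat_of_succ_lt fun k => ?_
    cases k with
    | zero => exact (c₀_peak_le_half 0).trans_lt half_lt_combHeight_zero
    | succ k => exact strictAnti_c₀_peak (Nat.lt_succ_self k)
  pos := fun k => by
    cases k with
    | zero => exact lt_trans (by positivity) half_lt_combHeight_zero
    | succ k => exact c₀_peak_pos k
  lim := (Filter.tendsto_add_atTop_iff_nat 1).1 tendsto_c₀_peak

theorem disk_half_nonneg_iff {t : ℝ} (ht : 1 / (2 * π) ≤ t) :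
    0 ≤ disk t (1 / (2 * π)) ↔ t ≤ combHeight 0 := by
  have hdisk := disk_add_sq t (1 / (2 * π))
  change _ ↔ t ≤ _ + _
  rw [← sub_le_iff_le_add', le_sqrt (sub_nonneg.2 ht) (by positivity), ← hdisk, sub_self]
  constructor <;> intro <;> linarith

theorem le_combHeight_zero {t x : ℝ} (h : 0 ≤ disk t x) : t ≤ combHeight 0 := by
  rcases le_total t (1 / (2 * π)) with ht | ht
  · exact ht.trans half_lt_combHeight_zero.le
  · exact (disk_half_nonneg_iff ht).1 (disk_nonneg_of_abs_le h le_rfl (by simp))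

/-- The map which sends a point of the region to the point of the comb which represents its
contour. -/
noncomputable def foldMap (d : ℝ × ℝ) : ℝ × ℝ := (d.1, max d.1 (runMax d.2))

theorem continuous_foldMap : Continuous foldMap := by
  have := continuous_runMax
  unfold foldMap
  fun_prop

theorem foldMap_mem_combSet {d : ℝ × ℝ} (hd : d ∈ region) : foldMap d ∈ combSet combHeight := by
  obtain ⟨t, x⟩ := d
  obtain ⟨hdisk, ht, hclamp⟩ := mem_region_iff.1 hd
  refine ⟨ht, le_max_left _ _, max_le (le_combHeight_zero hdisk)
    ((runMax_le_half x).trans half_lt_combHeight_zero.le), ?_⟩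
  change t = max t (runMax x) ∨ ∃ k, max t (runMax x) = c₀ (peak k)
  rcases le_or_gt (runMax x) t with h | h
  · exact Or.inl (max_eq_left h).symm
  · rw [max_eq_right h.le]
    exact Or.inr (exists_runMax_eq ht hclamp h)

theorem exists_foldMap_eq_diag {t : ℝ} (h0 : 0 ≤ t) (ht : t ≤ combHeight 0) :
    ∃ d ∈ region, foldMap d = (t, t) := by
  rcases le_total t (1 / (2 * π)) with hhalf | hhalf
  · have hmem : (0 : ℝ) ∈ Icc 0 (1 / π) := ⟨le_rfl, by positivity⟩
    refine ⟨(t, 0), mem_region_iff.2 ⟨disk_nonneg_of_mem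
      ⟨h0, hhalf.trans one_div_two_mul_pi_mem_Icc.2⟩ hmem, h0, ?_⟩, ?_⟩
    · rwa [clampPi_of_mem hmem, c₀_zero]
    · rw [foldMap, runMax_of_nonpos le_rfl, max_eq_left h0]
  · refine ⟨(t, 1 / (2 * π)), mem_region_iff.2 ⟨(disk_half_nonneg_iff hhalf).2 ht, h0, ?_⟩, ?_⟩
    · exact (c₀_le_half (clampPi_mem _).1 (clampPi_mem _).2).trans hhalf
    · rw [foldMap, max_eq_left ((runMax_le_half _).trans hhalf)]

theorem exists_foldMap_eq_tooth {t : ℝ} {k : ℕ} (h0 : 0 ≤ t) (ht : t ≤ c₀ (peak k)) :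
    ∃ d ∈ region, foldMap d = (t, c₀ (peak k)) := by
  have hmem : zeroPt k ∈ Icc 0 (1 / π) := ⟨(zeroPt_pos k).le, zeroPt_le k⟩
  refine ⟨(t, zeroPt k), mem_region_iff.2 ⟨disk_nonneg_of_mem
    ⟨h0, ht.trans ((c₀_peak_le_half k).trans one_div_two_mul_pi_mem_Icc.2)⟩ hmem, h0, ?_⟩, ?_⟩
  · rwa [clampPi_of_mem hmem, c₀_zeroPt]
  · rw [foldMap, runMax_zeroPt, max_eq_right ht]

theorem image_foldMap_region : foldMap '' region = combSet combHeight := by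
  refine (image_subset_iff.2 fun d => foldMap_mem_combSet).antisymm ?_
  rintro ⟨t, u⟩ ⟨h0, htu, hu, hspine | ⟨k, htooth⟩⟩
  · obtain rfl : t = u := hspine
    exact exists_foldMap_eq_diag h0 hu
  · obtain rfl : u = c₀ (peak k) := htooth
    exact exists_foldMap_eq_tooth h0 htu

theorem image_clampPi_Icc {x y : ℝ} (hxy : x ≤ y) :
    clampPi '' Icc x y = Icc (clampPi x) (clampPi y) :=
  (monotone_clampPi.mapsTo_Icc.image_subset).antisymm
    (intermediate_value_Icc hxy continuous_clampPi.continuousOn)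

theorem foldMap_eq_iff_forall_mem_region {t x y : ℝ} (hx : (t, x) ∈ region)
    (hy : (t, y) ∈ region) :
    foldMap (t, x) = foldMap (t, y) ↔ ∀ w ∈ uIcc x y, (t, w) ∈ region := by
  wlog hxy : x ≤ y generalizing x y
  · rw [eq_comm, uIcc_comm]
    exact this hy hx (le_of_not_ge hxy)
  obtain ⟨hdx, ht, hcx⟩ := mem_region_iff.1 hx
  obtain ⟨hdy, -, hcy⟩ := mem_region_iff.1 hy
  rw [uIcc_of_le hxy]
  calc foldMap (t, x) = foldMap (t, y) ↔ max t (runMax x) = max t (runMax y) := by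
        simp only [foldMap, Prod.mk.injEq, true_and]
    _ ↔ ∀ w ∈ Icc x y, c₀ (clampPi w) ≤ t := by
        rw [max_runMax_eq_iff ht hxy hcx hcy, ← image_clampPi_Icc hxy, forall_mem_image]
    _ ↔ ∀ w ∈ Icc x y, (t, w) ∈ region := forall₂_congr fun w hw => by
        rw [mem_region_iff]
        exact ⟨fun h => ⟨disk_nonneg_of_mem_Icc hdx hdy hw, ht, h⟩, fun h => h.2.2⟩

theorem isCompact_region : IsCompact region := by
  have hc := contDiff_c₀.continuous
  have hdisk : Continuous fun d : ℝ × ℝ => disk d.1 d.2 := by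
    unfold disk
    fun_prop
  have hbounded : region ⊆
      Metric.closedBall ((1 / (2 * π), 1 / (2 * π)) : ℝ × ℝ) √(1 / (2 * π ^ 2)) := by
    rintro ⟨t, x⟩ ⟨-, h⟩
    have hadd := disk_add_sq t x
    rw [Metric.mem_closedBall, Prod.dist_eq]
    exact max_le (abs_le_sqrt (by nlinarith)) (abs_le_sqrt (by nlinarith))
  exact Metric.isCompact_of_isClosed_isBounded
    ((isClosed_le continuous_const (continuous_fst.sub (hc.comp continuous_snd))).inter
      (isClosed_le continuous_const hdisk))
    (Metric.isBounded_closedBall.subset hbounded)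

theorem half_mem_region {x : ℝ} (h : 0 ≤ disk (1 / (2 * π)) x) : (1 / (2 * π), x) ∈ region :=
  mem_region_iff.2 ⟨h, by positivity, c₀_le_half (clampPi_mem x).1 (clampPi_mem x).2⟩

theorem mem_region_of_mem_uIcc {t x s : ℝ} (h : (t, x) ∈ region) (hs : s ∈ uIcc t (1 / (2 * π))) :
    (s, x) ∈ region := by
  obtain ⟨hdisk, -, hclamp⟩ := mem_region_iff.1 h
  have hle : c₀ (clampPi x) ≤ s :=
    (le_min hclamp (c₀_le_half (clampPi_mem x).1 (clampPi_mem x).2)).trans hs.1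
  refine mem_region_iff.2 ⟨disk_nonneg_of_abs_le hdisk ?_ le_rfl,
    (c₀_nonneg (clampPi_mem x).1).trans hle, hle⟩
  rw [abs_sub_comm s, abs_sub_comm t]
  exact abs_sub_right_of_mem_uIcc hs

theorem isConnected_region : IsConnected region := by
  set p := 1 / (2 * π)
  have hcenter : (p, p) ∈ region := half_mem_region
    (disk_nonneg_of_mem one_div_two_mul_pi_mem_Icc one_div_two_mul_pi_mem_Icc)
  refine ⟨⟨_, hcenter⟩, isPreconnected_of_forall (p, p) ?_⟩
  rintro ⟨t, x⟩ hd
  have hdisk : 0 ≤ disk p x := (mem_region_of_mem_uIcc hd right_mem_uIcc).2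
  refine ⟨(fun s : ℝ => (s, x)) '' uIcc t p ∪ (fun w : ℝ => (p, w)) '' uIcc p x, ?_, ?_, ?_, ?_⟩
  · rintro _ (⟨s, hs, rfl⟩ | ⟨w, hw, rfl⟩)
    · exact mem_region_of_mem_uIcc hd hs
    · exact half_mem_region (disk_nonneg_of_abs_le hdisk le_rfl (abs_sub_left_of_mem_uIcc hw))
  · exact Or.inr ⟨p, left_mem_uIcc, rfl⟩
  · exact Or.inl ⟨t, left_mem_uIcc, rfl⟩
  · exact IsPreconnected.union (p, x) ⟨p, right_mem_uIcc, rfl⟩ ⟨x, right_mem_uIcc, rfl⟩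
      (isPreconnected_uIcc.image _ (by fun_prop)) (isPreconnected_uIcc.image _ (by fun_prop))

theorem exists_mem_sphere_norm_smul_eq {E : Type*} [NormedAddCommGroup E] [NormedSpace ℝ E]
    [Nontrivial E] (y : E) : ∃ v ∈ Metric.sphere (0 : E) 1, ‖y‖ • v = y := by
  by_cases hy : y = 0
  · obtain ⟨v, hv⟩ := (NormedSpace.sphere_nonempty (x := (0 : E)) (r := 1)).2 zero_le_one
    exact ⟨v, hv, by simp [hy]⟩
  · refine ⟨‖y‖⁻¹ • y, by simp [norm_smul, hy], ?_⟩
    rw [smul_smul, mul_inv_cancel₀ (norm_ne_zero_iff.2 hy), one_smul]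

theorem isConnected_unitSphere {m : ℕ} (h : 1 < m) :
    IsConnected (Metric.sphere (0 : EuclideanSpace ℝ (Fin m)) 1) := by
  refine isConnected_sphere ?_ 0 zero_le_one
  rw [← Module.finrank_eq_rank, finrank_euclideanSpace_fin]
  exact_mod_cast h

/-- The homeomorphism of the Reeb space of `c` with a space `Z` which is induced by a map `f` to `Z`
whose fibres are the contours of `c`. -/
noncomputable def reebHomeomorph {X Y Z : Type*} [TopologicalSpace X] [TopologicalSpace Z]
    [CompactSpace X] [T2Space Z] (c : X → Y) (f : X → Z) (hf : Continuous f)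
    (hsurj : Function.Surjective f)
    (hfib : ∀ x y, f x = f y ↔ y ∈ connectedComponentIn (c ⁻¹' {c x}) x) : ReebSpace c ≃ₜ Z :=
  Continuous.homeoOfEquivCompactToT2
    (f := Equiv.ofBijective (Quotient.lift f fun x y h => (hfib x y).2 h)
      ⟨by rintro ⟨x⟩ ⟨y⟩ h; exact Quotient.sound ((hfib x y).1 h),
        fun z => (hsurj z).elim fun x hx => ⟨reebMap c x, hx⟩⟩)
    (hf.quotient_lift _)

section Contours

variable {m₁ m₂ : ℕ}

variable (m₁ m₂) in
/-- The first two coordinates. -/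
noncomputable def planePart (x : EuclideanSpace ℝ (Fin (m₁ + m₂ + 2))) : ℝ × ℝ :=
  ((coords m₁ m₂ x).1, (coords m₁ m₂ x).2.1)

theorem continuous_planePart : Continuous (planePart m₁ m₂) := by
  unfold planePart
  fun_prop

theorem mem_oscManifold_iff {x : EuclideanSpace ℝ (Fin (m₁ + m₂ + 2))} : x ∈ oscManifold m₁ m₂ ↔
    (planePart m₁ m₂ x).1 - c₀ (planePart m₁ m₂ x).2 = ‖(coords m₁ m₂ x).2.2.1‖ ^ 2 ∧
    disk (planePart m₁ m₂ x).1 (planePart m₁ m₂ x).2 = ‖(coords m₁ m₂ x).2.2.2‖ ^ 2 := by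
  rw [mem_oscManifold, leftFun, rightFun, sub_eq_zero, sub_eq_zero]
  rfl

theorem planePart_mem_region {x : EuclideanSpace ℝ (Fin (m₁ + m₂ + 2))}
    (hx : x ∈ oscManifold m₁ m₂) : planePart m₁ m₂ x ∈ region := by
  obtain ⟨h1, h2⟩ := mem_oscManifold_iff.1 hx
  exact ⟨h1 ▸ sq_nonneg _, h2 ▸ sq_nonneg _⟩

variable (m₁ m₂) in
/-- The point of the zero set of `eMap` with given first coordinates and directions of `y`, `z`. -/
noncomputable def liftMap (p : (ℝ × ℝ) × EuclideanSpace ℝ (Fin m₁) × EuclideanSpace ℝ (Fin m₂)) :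
    EuclideanSpace ℝ (Fin (m₁ + m₂ + 2)) :=
  (coords m₁ m₂).symm (p.1.1, p.1.2, √(p.1.1 - c₀ p.1.2) • p.2.1, √(disk p.1.1 p.1.2) • p.2.2)

theorem continuous_liftMap : Continuous (liftMap m₁ m₂) := by
  have hc := contDiff_c₀.continuous
  unfold liftMap disk
  fun_prop

theorem coords_liftMap
    (p : (ℝ × ℝ) × EuclideanSpace ℝ (Fin m₁) × EuclideanSpace ℝ (Fin m₂)) :
    coords m₁ m₂ (liftMap m₁ m₂ p) =
      (p.1.1, p.1.2, √(p.1.1 - c₀ p.1.2) • p.2.1, √(disk p.1.1 p.1.2) • p.2.2) :=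
  (coords m₁ m₂).apply_symm_apply _

theorem planePart_liftMap
    (p : (ℝ × ℝ) × EuclideanSpace ℝ (Fin m₁) × EuclideanSpace ℝ (Fin m₂)) :
    planePart m₁ m₂ (liftMap m₁ m₂ p) = p.1 := by
  rw [planePart, coords_liftMap]

theorem liftMap_mem_oscManifold
    {p : (ℝ × ℝ) × EuclideanSpace ℝ (Fin m₁) × EuclideanSpace ℝ (Fin m₂)} (hd : p.1 ∈ region)
    (hy : ‖p.2.1‖ = 1) (hz : ‖p.2.2‖ = 1) : liftMap m₁ m₂ p ∈ oscManifold m₁ m₂ := by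
  rw [mem_oscManifold_iff, planePart_liftMap, coords_liftMap]
  simp only [norm_smul, hy, hz, mul_one, norm_eq_abs, sq_abs, sq_sqrt hd.1, sq_sqrt hd.2, and_self]

theorem exists_liftMap_eq [Nontrivial (EuclideanSpace ℝ (Fin m₁))]
    [Nontrivial (EuclideanSpace ℝ (Fin m₂))] {x : EuclideanSpace ℝ (Fin (m₁ + m₂ + 2))}
    (hx : x ∈ oscManifold m₁ m₂) : ∃ v ∈ Metric.sphere 0 1, ∃ w ∈ Metric.sphere 0 1,
      liftMap m₁ m₂ (planePart m₁ m₂ x, v, w) = x := by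
  obtain ⟨ha, hb⟩ := mem_oscManifold_iff.1 hx
  obtain ⟨v, hv, hyv⟩ := exists_mem_sphere_norm_smul_eq (coords m₁ m₂ x).2.2.1
  obtain ⟨w, hw, hzw⟩ := exists_mem_sphere_norm_smul_eq (coords m₁ m₂ x).2.2.2
  refine ⟨v, hv, w, hw, (coords m₁ m₂).injective ?_⟩
  simp only [coords_liftMap, ha, hb, sqrt_sq (norm_nonneg _), hyv, hzw]
  rfl

theorem image_liftMap_prod (h₁ : 1 < m₁) (h₂ : 1 < m₂) {K : Set (ℝ × ℝ)} (hK : K ⊆ region) :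
    liftMap m₁ m₂ '' (K ×ˢ Metric.sphere 0 1 ×ˢ Metric.sphere 0 1) =
      {x ∈ oscManifold m₁ m₂ | planePart m₁ m₂ x ∈ K} := by
  have : Nontrivial (EuclideanSpace ℝ (Fin m₁)) :=
    Module.nontrivial_of_finrank_pos (R := ℝ) (by rw [finrank_euclideanSpace_fin]; omega)
  have : Nontrivial (EuclideanSpace ℝ (Fin m₂)) :=
    Module.nontrivial_of_finrank_pos (R := ℝ) (by rw [finrank_euclideanSpace_fin]; omega)
  refine Subset.antisymm ?_ ?_
  · rintro _ ⟨p, ⟨hd, hy, hz⟩, rfl⟩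
    refine ⟨liftMap_mem_oscManifold (hK hd) (mem_sphere_zero_iff_norm.1 hy)
      (mem_sphere_zero_iff_norm.1 hz), ?_⟩
    rwa [planePart_liftMap]
  · rintro x ⟨hx, hd⟩
    obtain ⟨v, hv, w, hw, hxvw⟩ := exists_liftMap_eq hx
    exact ⟨(planePart m₁ m₂ x, v, w), ⟨hd, hv, hw⟩, hxvw⟩

theorem isConnected_setOf_planePart_mem (h₁ : 1 < m₁) (h₂ : 1 < m₂) {K : Set (ℝ × ℝ)}
    (hK : K ⊆ region) (hc : IsConnected K) :
    IsConnected {x ∈ oscManifold m₁ m₂ | planePart m₁ m₂ x ∈ K} := by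
  rw [← image_liftMap_prod h₁ h₂ hK]
  exact (hc.prod ((isConnected_unitSphere h₁).prod (isConnected_unitSphere h₂))).image _
    continuous_liftMap.continuousOn

theorem setOf_planePart_mem_region :
    {x ∈ oscManifold m₁ m₂ | planePart m₁ m₂ x ∈ region} = oscManifold m₁ m₂ :=
  sep_eq_self_iff_mem_true.2 fun _ => planePart_mem_region

theorem isCompact_oscManifold (h₁ : 1 < m₁) (h₂ : 1 < m₂) : IsCompact (oscManifold m₁ m₂) := by
  rw [← setOf_planePart_mem_region, ← image_liftMap_prod h₁ h₂ Subset.rfl]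
  exact (isCompact_region.prod ((isCompact_sphere _ _).prod (isCompact_sphere _ _))).image
    continuous_liftMap

theorem isConnected_oscManifold (h₁ : 1 < m₁) (h₂ : 1 < m₂) : IsConnected (oscManifold m₁ m₂) := by
  rw [← setOf_planePart_mem_region]
  exact isConnected_setOf_planePart_mem h₁ h₂ Subset.rfl isConnected_region

theorem exists_planePart_eq (h₁ : 1 < m₁) (h₂ : 1 < m₂) {d : ℝ × ℝ} (hd : d ∈ region) :
    ∃ x ∈ oscManifold m₁ m₂, planePart m₁ m₂ x = d :=
  (isConnected_setOf_planePart_mem h₁ h₂ (singleton_subset_iff.2 hd) isConnected_singleton).nonempty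

variable (m₁ m₂) in
/-- The function `cFun` for the parameters chosen here. -/
noncomputable abbrev oscHeight : oscManifold m₁ m₂ → ℝ :=
  cFun (1 / (2 * π)) (1 / (2 * π)) 1 1 (1 / (2 * π ^ 2)) m₁ m₂

variable (m₁ m₂) in
/-- The map from the zero set of `eMap` to the comb which collapses the contours. -/
noncomputable def toComb (x : oscManifold m₁ m₂) : combSet combHeight :=
  ⟨foldMap (planePart m₁ m₂ x), foldMap_mem_combSet (planePart_mem_region x.2)⟩

theorem continuous_toComb : Continuous (toComb m₁ m₂) :=
  (continuous_foldMap.comp (continuous_planePart.comp continuous_subtype_val)).subtype_mk _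

theorem surjective_toComb (h₁ : 1 < m₁) (h₂ : 1 < m₂) : Function.Surjective (toComb m₁ m₂) := by
  rintro ⟨g, hg⟩
  obtain ⟨d, hd, rfl⟩ := image_foldMap_region.ge hg
  obtain ⟨x, hx, rfl⟩ := exists_planePart_eq h₁ h₂ hd
  exact ⟨⟨x, hx⟩, rfl⟩

theorem toComb_eq_iff {x y : oscManifold m₁ m₂} : toComb m₁ m₂ x = toComb m₁ m₂ y ↔
    (planePart m₁ m₂ y).1 = (planePart m₁ m₂ x).1 ∧
      ∀ w ∈ uIcc (planePart m₁ m₂ x).2 (planePart m₁ m₂ y).2,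
        ((planePart m₁ m₂ x).1, w) ∈ region := by
  have hx := planePart_mem_region x.2
  have hy := planePart_mem_region y.2
  rw [toComb, toComb, Subtype.mk.injEq]
  generalize planePart m₁ m₂ x = d at hx ⊢
  generalize planePart m₁ m₂ y = d' at hy ⊢
  obtain ⟨t, a⟩ := d
  obtain ⟨t', b⟩ := d'
  constructor
  · intro h
    obtain rfl : t' = t := (congrArg Prod.fst h).symm
    exact ⟨rfl, (foldMap_eq_iff_forall_mem_region hx hy).1 h⟩
  · rintro ⟨h, hregion⟩
    obtain rfl : t' = t := h
    exact (foldMap_eq_iff_forall_mem_region hx hy).2 hregion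

theorem toComb_eq_of_mem_contour {x y : oscManifold m₁ m₂}
    (h : y ∈ connectedComponentIn (oscHeight m₁ m₂ ⁻¹' {oscHeight m₁ m₂ x}) x) :
    toComb m₁ m₂ x = toComb m₁ m₂ y := by
  set C := connectedComponentIn (oscHeight m₁ m₂ ⁻¹' {oscHeight m₁ m₂ x}) x
  have hx : x ∈ C := mem_connectedComponentIn rfl
  have hlevel : ∀ z ∈ C, (planePart m₁ m₂ z).1 = (planePart m₁ m₂ x).1 :=
    connectedComponentIn_subset (oscHeight m₁ m₂ ⁻¹' {oscHeight m₁ m₂ x}) x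
  have hcont : Continuous fun z : oscManifold m₁ m₂ => (planePart m₁ m₂ z).2 :=
    continuous_snd.comp (continuous_planePart.comp continuous_subtype_val)
  have hpre : IsPreconnected ((fun z : oscManifold m₁ m₂ => (planePart m₁ m₂ z).2) '' C) :=
    isPreconnected_connectedComponentIn.image _ hcont.continuousOn
  refine toComb_eq_iff.2 ⟨hlevel y h, fun w hw => ?_⟩
  obtain ⟨z, hz, rfl⟩ :=
    hpre.ordConnected.uIcc_subset (mem_image_of_mem _ hx) (mem_image_of_mem _ h) hw
  exact hlevel z hz ▸ planePart_mem_region z.2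

theorem mem_contour_of_toComb_eq (h₁ : 1 < m₁) (h₂ : 1 < m₂) {x y : oscManifold m₁ m₂}
    (h : toComb m₁ m₂ x = toComb m₁ m₂ y) :
    y ∈ connectedComponentIn (oscHeight m₁ m₂ ⁻¹' {oscHeight m₁ m₂ x}) x := by
  obtain ⟨hheight, hregion⟩ := toComb_eq_iff.1 h
  set t := (planePart m₁ m₂ x).1
  set K := (fun w : ℝ => (t, w)) '' uIcc (planePart m₁ m₂ x).2 (planePart m₁ m₂ y).2
  have hK : IsConnected K :=
    ⟨nonempty_uIcc.image _, isPreconnected_uIcc.image _ (by fun_prop)⟩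
  have hpre : IsPreconnected ((↑) ⁻¹' (planePart m₁ m₂ ⁻¹' K) : Set (oscManifold m₁ m₂)) := by
    rw [← IsInducing.subtypeVal.isPreconnected_image, Subtype.image_preimage_coe]
    exact (isConnected_setOf_planePart_mem h₁ h₂ (image_subset_iff.2 hregion) hK).isPreconnected
  refine hpre.subset_connectedComponentIn ⟨_, left_mem_uIcc, rfl⟩ ?_
    ⟨_, right_mem_uIcc, Prod.ext hheight.symm rfl⟩
  rintro z ⟨w, -, hw⟩
  exact (congrArg Prod.fst hw).symm

/-- The homeomorphism of the Reeb space with the comb. -/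
noncomputable def reebHomeo (h₁ : 1 < m₁) (h₂ : 1 < m₂) :
    ReebSpace (oscHeight m₁ m₂) ≃ₜ combSet combHeight :=
  have : CompactSpace (oscManifold m₁ m₂) :=
    isCompact_iff_compactSpace.1 (isCompact_oscManifold h₁ h₂)
  reebHomeomorph _ (toComb m₁ m₂) continuous_toComb (surjective_toComb h₁ h₂) fun _ _ =>
    ⟨mem_contour_of_toComb_eq h₁ h₂, toComb_eq_of_mem_contour⟩

end Contours

theorem mem_Icc_of_disk_nonneg {x : ℝ} (h : 0 ≤ disk (c₀ x) x) : x ∈ Icc 0 (1 / π) := by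
  constructor
  · by_contra! hx
    exact (c₀_nonpos hx.le).not_gt (pos_of_disk_nonneg hx h)
  · by_contra! hx
    exact lt_irrefl _ (c₀_lt_of_disk_nonneg hx h)

theorem eq_zero_or_eq_one_div_pi_of_disk_eq_zero {x : ℝ} (h : disk (c₀ x) x = 0) :
    x = 0 ∨ x = 1 / π := by
  have hx := mem_Icc_of_disk_nonneg h.ge
  have hc₀ : c₀ x ≤ 1 / π := (c₀_le_half hx.1 hx.2).trans one_div_two_mul_pi_mem_Icc.2
  have hx0 : x * (1 / π - x) = 0 := ((add_eq_zero_iff_of_nonneg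
    (mul_nonneg (c₀_nonneg hx.1) (sub_nonneg.2 hc₀))
    (mul_nonneg hx.1 (sub_nonneg.2 hx.2))).1 h).2
  exact (mul_eq_zero.1 hx0).imp_right fun hsub => (sub_eq_zero.1 hsub).symm

theorem deriv_c₀_eq_zero_of_disk_eq_zero {x : ℝ} (h : disk (c₀ x) x = 0) : deriv c₀ x = 0 := by
  rcases eq_zero_or_eq_one_div_pi_of_disk_eq_zero h with rfl | rfl
  · exact hasDerivAt_c₀_zero.deriv
  · rw [← zeroPt_zero, deriv_c₀_zeroPt]

theorem one_div_pi_sub_ne_zero_of_disk_eq_zero {x : ℝ} (h : disk (c₀ x) x = 0) :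
    1 / π - 2 * x ≠ 0 := by
  have hpi : (0 : ℝ) < 1 / π := by positivity
  rcases eq_zero_or_eq_one_div_pi_of_disk_eq_zero h with rfl | rfl <;> intro <;> linarith

-- The gradient of `disk` vanishes at the centre of the disk only.
theorem ne_zero_or_ne_zero_of_disk_eq_zero {t x : ℝ} (h : disk t x = 0) :
    1 / π - 2 * t ≠ 0 ∨ 1 / π - 2 * x ≠ 0 := by
  have hpi : (0 : ℝ) < 1 / π := by positivity
  by_contra! hne
  unfold disk at h
  nlinarith

section LinearSystem

variable {E F : Type*} [NormedAddCommGroup E] [InnerProductSpace ℝ E] [NormedAddCommGroup F]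
  [InnerProductSpace ℝ F]

theorem exists_two_mul_inner_eq {y : E} (hy : y ≠ 0) (c : ℝ) : ∃ η : E, 2 * inner ℝ y η = c := by
  refine ⟨(c / (2 * ‖y‖ ^ 2)) • y, ?_⟩
  rw [inner_smul_right, real_inner_self_eq_norm_sq]
  field_simp

theorem exists_linear_system_solution {a α β : ℝ} {y : E} {z : F}
    (h : z ≠ 0 ∨ (y ≠ 0 ∧ (α ≠ 0 ∨ β ≠ 0)) ∨ β + α * a ≠ 0) (u v : ℝ) :
    ∃ w : ℝ × ℝ × E × F, w.1 - a * w.2.1 - 2 * inner ℝ y w.2.2.1 = u ∧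
      α * w.1 + β * w.2.1 - 2 * inner ℝ z w.2.2.2 = v := by
  rcases h with hz | ⟨hy, hαβ⟩ | hdet
  · obtain ⟨ζ, hζ⟩ := exists_two_mul_inner_eq hz (α * u - v)
    exact ⟨(u, 0, 0, ζ), by simp, by simp [hζ]⟩
  · obtain ⟨t, x, htx⟩ : ∃ t x, α * t + β * x = v := by
      rcases hαβ with hα | hβ
      · exact ⟨v / α, 0, by rw [mul_div_cancel₀ _ hα, mul_zero, add_zero]⟩
      · exact ⟨0, v / β, by rw [mul_div_cancel₀ _ hβ, mul_zero, zero_add]⟩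
    obtain ⟨η, hη⟩ := exists_two_mul_inner_eq hy (t - a * x - u)
    exact ⟨(t, x, η, 0), by simp [hη], by simp [htx]⟩
  · refine ⟨((β * u + a * v) / (β + α * a), (v - α * u) / (β + α * a), 0, 0), ?_, ?_⟩
    · rw [inner_zero_right, mul_zero, sub_zero, mul_div_assoc', ← sub_div, div_eq_iff hdet]
      ring
    · rw [inner_zero_right, mul_zero, sub_zero, mul_div_assoc', mul_div_assoc', ← add_div,
        div_eq_iff hdet]
      ring

theorem forall_linear_system_fst_eq_zero_iff {a α β : ℝ} {y : E} {z : F}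
    (hyz : y = 0 → z = 0 → a = 0) (hz : z = 0 → α ≠ 0 ∨ β ≠ 0) :
    (∀ w : ℝ × ℝ × E × F, w.1 - a * w.2.1 - 2 * inner ℝ y w.2.2.1 = 0 →
      α * w.1 + β * w.2.1 - 2 * inner ℝ z w.2.2.2 = 0 → w.1 = 0) ↔
      y = 0 ∧ a = 0 ∨ z = 0 ∧ β = 0 := by
  constructor
  · intro hw
    by_contra! hne
    obtain ⟨x, η, hη⟩ : ∃ x η, 1 - a * x - 2 * inner ℝ y η = 0 ∧ (z = 0 → α + β * x = 0) := by
      by_cases hy : y = 0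
      · exact ⟨a⁻¹, 0, by simp [hne.1 hy], fun hz0 => absurd (hyz hy hz0) (hne.1 hy)⟩
      · obtain ⟨η, hη⟩ := exists_two_mul_inner_eq hy (1 - a * (-α / β))
        refine ⟨-α / β, η, sub_eq_zero.2 hη.symm, fun hz0 => ?_⟩
        rw [mul_div_cancel₀ _ (hne.2 hz0), add_neg_cancel]
    obtain ⟨ζ, hζ⟩ : ∃ ζ, 2 * inner ℝ z ζ = α + β * x := by
      by_cases hz0 : z = 0
      · exact ⟨0, by simp [hη.2 hz0]⟩
      · exact exists_two_mul_inner_eq hz0 _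
    exact one_ne_zero (hw (1, x, η, ζ) hη.1 (by simp [hζ]))
  · rintro (⟨rfl, rfl⟩ | ⟨rfl, rfl⟩) w h₁ h₂
    · simpa using h₁
    · simpa [(hz rfl).resolve_right (not_not.2 rfl)] using h₂

end LinearSystem

section Derivatives

variable {m₁ m₂ : ℕ}
  {γ : ℝ → ℝ × ℝ × EuclideanSpace ℝ (Fin m₁) × EuclideanSpace ℝ (Fin m₂)}
  {w : ℝ × ℝ × EuclideanSpace ℝ (Fin m₁) × EuclideanSpace ℝ (Fin m₂)} {s : ℝ}

theorem hasDerivAt_leftFun (h : HasDerivAt γ w s) : HasDerivAt (fun s => leftFun (γ s))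
    (w.1 - deriv c₀ (γ s).2.1 * w.2.1 - 2 * inner ℝ (γ s).2.2.1 w.2.2.1) s := by
  have hsnd := hasFDerivAt_snd.comp_hasDerivAt s h
  have ht : HasDerivAt (fun s => (γ s).1) w.1 s :=
    (hasFDerivAt_fst.comp_hasDerivAt s h :)
  have hx : HasDerivAt (fun s => (γ s).2.1) w.2.1 s :=
    (hasFDerivAt_fst.comp_hasDerivAt s hsnd :)
  have hy : HasDerivAt (fun s => (γ s).2.2.1) w.2.2.1 s :=
    (hasFDerivAt_fst.comp_hasDerivAt s (hasFDerivAt_snd.comp_hasDerivAt s hsnd) :)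
  exact (ht.sub ((differentiable_c₀ _).hasDerivAt.comp s hx)).sub hy.norm_sq

theorem hasDerivAt_rightFun (h : HasDerivAt γ w s) : HasDerivAt (fun s => rightFun (γ s))
    ((1 / π - 2 * (γ s).1) * w.1 + (1 / π - 2 * (γ s).2.1) * w.2.1 -
      2 * inner ℝ (γ s).2.2.2 w.2.2.2) s := by
  have hsnd := hasFDerivAt_snd.comp_hasDerivAt s h
  have ht : HasDerivAt (fun s => (γ s).1) w.1 s :=
    (hasFDerivAt_fst.comp_hasDerivAt s h :)
  have hx : HasDerivAt (fun s => (γ s).2.1) w.2.1 s :=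
    (hasFDerivAt_fst.comp_hasDerivAt s hsnd :)
  have hz : HasDerivAt (fun s => (γ s).2.2.2) w.2.2.2 s :=
    (hasFDerivAt_snd.comp_hasDerivAt s (hasFDerivAt_snd.comp_hasDerivAt s hsnd) :)
  have hdisk := (ht.mul (ht.const_sub (1 / π))).add (hx.mul (hx.const_sub (1 / π)))
  refine (hdisk.sub hz.norm_sq).congr_deriv ?_
  ring

end Derivatives

section CriticalPoints

/-- The projection to the region of the critical points of the height function. -/
def criticalSet : Set (ℝ × ℝ) := {d ∈ region |
  (d.1 = c₀ d.2 ∧ deriv c₀ d.2 = 0) ∨ (disk d.1 d.2 = 0 ∧ d.2 = 1 / (2 * π))}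

variable {m₁ m₂ : ℕ} {x : EuclideanSpace ℝ (Fin (m₁ + m₂ + 2))}

theorem fderiv_oscMap (x v : EuclideanSpace ℝ (Fin (m₁ + m₂ + 2))) :
    fderiv ℝ (oscMap m₁ m₂) x v = !₂[
      (coords m₁ m₂ v).1 - deriv c₀ (planePart m₁ m₂ x).2 * (coords m₁ m₂ v).2.1 -
        2 * inner ℝ (coords m₁ m₂ x).2.2.1 (coords m₁ m₂ v).2.2.1,
      (1 / π - 2 * (planePart m₁ m₂ x).1) * (coords m₁ m₂ v).1 +
        (1 / π - 2 * (planePart m₁ m₂ x).2) * (coords m₁ m₂ v).2.1 -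
        2 * inner ℝ (coords m₁ m₂ x).2.2.2 (coords m₁ m₂ v).2.2.2] := by
  have hline : HasDerivAt (fun s : ℝ => coords m₁ m₂ (x + s • v)) (coords m₁ m₂ v) 0 := by
    refine (coords m₁ m₂).hasFDerivAt.comp_hasDerivAt 0 ?_
    simpa using ((hasDerivAt_id (0 : ℝ)).smul_const v).const_add x
  have hleft := hasDerivAt_leftFun hline
  have hright := hasDerivAt_rightFun hline
  simp only [zero_smul, add_zero] at hleft hright
  have hdiff : DifferentiableAt ℝ (oscMap m₁ m₂) x :=
    (contDiff_eMap ..).differentiable (by simp) x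
  rw [← hdiff.lineDeriv_eq_fderiv]
  refine HasLineDerivAt.lineDeriv ?_
  simp only [HasLineDerivAt, oscMap_eq]
  have hpi : HasDerivAt (fun s : ℝ => ![leftFun (coords m₁ m₂ (x + s • v)),
      rightFun (coords m₁ m₂ (x + s • v))]) ![_, _] 0 :=
    hasDerivAt_pi.2 (Fin.forall_fin_two.2 ⟨hleft, hright⟩)
  exact (PiLp.hasFDerivAt_toLp 2 _).comp_hasDerivAt (0 : ℝ) hpi

theorem snd_snd_fst_coords_eq_zero_iff (hx : x ∈ oscManifold m₁ m₂) :
    (coords m₁ m₂ x).2.2.1 = 0 ↔ (planePart m₁ m₂ x).1 = c₀ (planePart m₁ m₂ x).2 := by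
  rw [← sub_eq_zero (b := c₀ _), (mem_oscManifold_iff.1 hx).1, sq_eq_zero_iff, norm_eq_zero]

theorem snd_snd_snd_coords_eq_zero_iff (hx : x ∈ oscManifold m₁ m₂) :
    (coords m₁ m₂ x).2.2.2 = 0 ↔ disk (planePart m₁ m₂ x).1 (planePart m₁ m₂ x).2 = 0 := by
  rw [(mem_oscManifold_iff.1 hx).2, sq_eq_zero_iff, norm_eq_zero]

theorem surjective_fderiv_oscMap (hx : x ∈ oscManifold m₁ m₂) :
    Function.Surjective (fderiv ℝ (oscMap m₁ m₂) x) := by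
  have hrank : (coords m₁ m₂ x).2.2.2 ≠ 0 ∨ ((coords m₁ m₂ x).2.2.1 ≠ 0 ∧
      (1 / π - 2 * (planePart m₁ m₂ x).1 ≠ 0 ∨ 1 / π - 2 * (planePart m₁ m₂ x).2 ≠ 0)) ∨
      1 / π - 2 * (planePart m₁ m₂ x).2 +
        (1 / π - 2 * (planePart m₁ m₂ x).1) * deriv c₀ (planePart m₁ m₂ x).2 ≠ 0 := by
    refine or_iff_not_imp_left.2 fun hz => ?_
    have hdisk := (snd_snd_snd_coords_eq_zero_iff hx).1 (not_not.1 hz)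
    by_cases hy : (coords m₁ m₂ x).2.2.1 = 0
    · rw [(snd_snd_fst_coords_eq_zero_iff hx).1 hy] at hdisk
      rw [deriv_c₀_eq_zero_of_disk_eq_zero hdisk, mul_zero, add_zero]
      exact Or.inr (one_div_pi_sub_ne_zero_of_disk_eq_zero hdisk)
    · exact Or.inl ⟨hy, ne_zero_or_ne_zero_of_disk_eq_zero hdisk⟩
  intro b
  obtain ⟨w, hw⟩ := exists_linear_system_solution hrank (b 0) (b 1)
  refine ⟨(coords m₁ m₂).symm w, ?_⟩
  rw [fderiv_oscMap, (coords m₁ m₂).apply_symm_apply]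
  exact PiLp.ext (Fin.forall_fin_two.2 hw)

theorem isSmoothSubmanifold_oscManifold (m₁ m₂ : ℕ) :
    IsSmoothSubmanifold (m₁ + m₂) (oscManifold m₁ m₂) :=
  isSmoothSubmanifold_preimage_zero rfl (contDiff_eMap ..) fun _ hx => surjective_fderiv_oscMap hx

theorem isCriticalPointOn_iff (hx : x ∈ oscManifold m₁ m₂) :
    IsCriticalPointOn (oscManifold m₁ m₂) (fun y => y 0) x ↔ planePart m₁ m₂ x ∈ criticalSet := by
  have hβ : (planePart m₁ m₂ x).2 = 1 / (2 * π) ↔ 1 / π - 2 * (planePart m₁ m₂ x).2 = 0 := by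
    field_simp
    constructor <;> intro h <;> linarith
  have hproj (v : EuclideanSpace ℝ (Fin (m₁ + m₂ + 2))) :
      fderiv ℝ (fun y : EuclideanSpace ℝ (Fin (m₁ + m₂ + 2)) => y 0) x v = (coords m₁ m₂ v).1 :=
    congrArg (· v) (EuclideanSpace.proj (𝕜 := ℝ) (0 : Fin (m₁ + m₂ + 2))).hasFDerivAt.fderiv
  have htangent (v : EuclideanSpace ℝ (Fin (m₁ + m₂ + 2))) :
      v ∈ tangentVectors (oscManifold m₁ m₂) x ↔ fderiv ℝ (oscMap m₁ m₂) x v = 0 :=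
    mem_tangentVectors_preimage_zero_iff rfl (contDiff_eMap ..) hx (surjective_fderiv_oscMap hx)
  have hcritical : planePart m₁ m₂ x ∈ criticalSet ↔
      (coords m₁ m₂ x).2.2.1 = 0 ∧ deriv c₀ (planePart m₁ m₂ x).2 = 0 ∨
      (coords m₁ m₂ x).2.2.2 = 0 ∧ 1 / π - 2 * (planePart m₁ m₂ x).2 = 0 :=
    (and_iff_right (planePart_mem_region hx)).trans (or_congr
      (and_congr_left' (snd_snd_fst_coords_eq_zero_iff hx).symm)
      (and_congr (snd_snd_snd_coords_eq_zero_iff hx).symm hβ))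
  have hyz (hy : (coords m₁ m₂ x).2.2.1 = 0) (hz : (coords m₁ m₂ x).2.2.2 = 0) :
      deriv c₀ (planePart m₁ m₂ x).2 = 0 := by
    have hdisk := (snd_snd_snd_coords_eq_zero_iff hx).1 hz
    rw [(snd_snd_fst_coords_eq_zero_iff hx).1 hy] at hdisk
    exact deriv_c₀_eq_zero_of_disk_eq_zero hdisk
  rw [hcritical, ← forall_linear_system_fst_eq_zero_iff hyz fun hz =>
    ne_zero_or_ne_zero_of_disk_eq_zero ((snd_snd_snd_coords_eq_zero_iff hx).1 hz)]
  refine (and_iff_right hx).trans (Iff.trans ?_ (coords m₁ m₂).surjective.forall.symm)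
  refine forall_congr' fun v => ?_
  rw [htangent, hproj, fderiv_oscMap, PiLp.ext_iff, Fin.forall_fin_two, and_imp]
  rfl

end CriticalPoints

theorem disk_half_eq_zero_iff {t : ℝ} (ht : 0 ≤ t) :
    disk t (1 / (2 * π)) = 0 ↔ t = combHeight 0 := by
  have hdisk := disk_add_sq t (1 / (2 * π))
  rcases lt_or_ge t (1 / (2 * π)) with hlt | hge
  · have hlt' := hlt.trans_le one_div_two_mul_pi_mem_Icc.2
    have hpos : 0 < disk t (1 / (2 * π)) := by
      have hsub : (0 : ℝ) < 1 / π - 1 / (2 * π) := by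
        rw [show (1 : ℝ) / π - 1 / (2 * π) = 1 / (2 * π) by field_simp; norm_num]
        positivity
      exact add_pos_of_nonneg_of_pos (mul_nonneg ht (sub_pos.2 hlt').le)
        (mul_pos (by positivity) hsub)
    exact iff_of_false hpos.ne' (hlt.trans half_lt_combHeight_zero).ne
  · change _ ↔ t = 1 / (2 * π) + √(1 / (2 * π ^ 2))
    rw [← sub_eq_iff_eq_add', eq_comm (b := √_),
      sqrt_eq_iff_eq_sq (by positivity) (sub_nonneg.2 hge), ← hdisk, sub_self]
    constructor <;> intro <;> linarith

theorem mem_criticalSet_of_deriv_c₀_eq_zero {x : ℝ} (hx : x ∈ Icc 0 (1 / π))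
    (h : deriv c₀ x = 0) : (c₀ x, x) ∈ criticalSet :=
  ⟨⟨(sub_self _).ge, disk_nonneg_of_mem
    ⟨c₀_nonneg hx.1, (c₀_le_half hx.1 hx.2).trans one_div_two_mul_pi_mem_Icc.2⟩ hx⟩,
    Or.inl ⟨rfl, h⟩⟩

theorem mem_criticalSet_iff {d : ℝ × ℝ} : d ∈ criticalSet ↔ d = (0, 0) ∨
    (∃ k, d = (0, zeroPt k)) ∨ (∃ k, d = (c₀ (peak k), peak k)) ∨
      d = (combHeight 0, 1 / (2 * π)) := by
  constructor
  · obtain ⟨t, x⟩ := d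
    rintro ⟨hd, ⟨ht, hderiv⟩ | ⟨hdisk, rfl⟩⟩
    · obtain rfl : t = c₀ x := ht
      obtain ⟨hx0, hx1⟩ := mem_Icc_of_disk_nonneg hd.2
      rcases hx0.eq_or_lt with rfl | hx0
      · exact Or.inl (by rw [c₀_zero])
      · rcases exists_eq_zeroPt_or_eq_peak hx0 hx1 hderiv with ⟨k, rfl⟩ | ⟨k, rfl⟩
        · exact Or.inr (Or.inl ⟨k, by rw [c₀_zeroPt]⟩)
        · exact Or.inr (Or.inr (Or.inl ⟨k, rfl⟩))
    · have ht := (disk_half_eq_zero_iff (mem_region_iff.1 hd).2.1).1 hdisk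
      exact Or.inr (Or.inr (Or.inr (by rw [ht])))
  · rintro (rfl | ⟨k, rfl⟩ | ⟨k, rfl⟩ | rfl)
    · simpa only [c₀_zero] using mem_criticalSet_of_deriv_c₀_eq_zero
        (left_mem_Icc.2 (by positivity)) hasDerivAt_c₀_zero.deriv
    · simpa only [c₀_zeroPt] using mem_criticalSet_of_deriv_c₀_eq_zero
        ⟨(zeroPt_pos k).le, zeroPt_le k⟩ (deriv_c₀_zeroPt k)
    · exact mem_criticalSet_of_deriv_c₀_eq_zero
        ⟨(peak_pos k).le, (peak_mem k).2.le.trans (zeroPt_le k)⟩ (deriv_c₀_peak k)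
    · have hdisk := (disk_half_eq_zero_iff (isCombSeq_combHeight.pos 0).le).2 rfl
      refine ⟨mem_region_iff.2 ⟨hdisk.ge, (isCombSeq_combHeight.pos 0).le, ?_⟩,
        Or.inr ⟨hdisk, rfl⟩⟩
      exact (c₀_le_half (clampPi_mem _).1 (clampPi_mem _).2).trans half_lt_combHeight_zero.le

theorem foldMap_zero : foldMap (0, 0) = (0, 0) := by
  rw [foldMap, runMax_of_nonpos le_rfl, max_self]

theorem foldMap_zeroPt (k : ℕ) : foldMap (0, zeroPt k) = (0, combHeight (k + 1)) := by
  rw [foldMap, runMax_zeroPt, max_eq_right (c₀_peak_pos k).le]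
  rfl

theorem foldMap_peak (k : ℕ) :
    foldMap (c₀ (peak k), peak k) = (combHeight (k + 1), combHeight (k + 1)) := by
  rw [foldMap, runMax_peak, max_self]
  rfl

theorem foldMap_combHeight_zero :
    foldMap (combHeight 0, 1 / (2 * π)) = (combHeight 0, combHeight 0) := by
  rw [foldMap, max_eq_left ((runMax_le_half _).trans half_lt_combHeight_zero.le)]

theorem image_foldMap_criticalSet :
    foldMap '' criticalSet = insert (0, 0) (IsCombSeq.vertexSet combHeight) := by
  have hset : criticalSet = insert (0, 0) (range (fun k => (0, zeroPt k)) ∪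
      (range (fun k => (c₀ (peak k), peak k)) ∪ {(combHeight 0, 1 / (2 * π))})) := by
    ext d
    rw [mem_criticalSet_iff]
    simp only [mem_insert_iff, mem_union, mem_range, mem_singleton_iff, eq_comm]
  rw [hset, image_insert_eq, image_union, image_union, image_singleton, ← range_comp, ← range_comp,
    foldMap_zero, foldMap_combHeight_zero, IsCombSeq.vertexSet,
    ← Nat.range_of_succ fun k => (combHeight k, combHeight k), union_comm {_},
    union_comm _ (range _)]
  simp only [Function.comp_def, foldMap_zeroPt, foldMap_peak]

theorem foldMap_eq_zero_iff {d : ℝ × ℝ} (hd : d ∈ region) : foldMap d = (0, 0) ↔ d = (0, 0) := by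
  refine ⟨fun h => ?_, fun h => by rw [h, foldMap_zero]⟩
  obtain ⟨t, x⟩ := d
  obtain ⟨rfl, hmax⟩ := Prod.mk.inj h
  have hx0 : 0 ≤ x := not_lt.1 fun hx => lt_irrefl _ (pos_of_disk_nonneg hx hd.2)
  refine Prod.ext rfl (hx0.eq_of_not_lt fun hx => ?_).symm
  obtain ⟨k, hk⟩ := (isCombSeq_zeroPt.lim.eventually (gt_mem_nhds hx)).exists
  refine (c₀_peak_pos k).not_ge ?_
  calc c₀ (peak k) = runMax (zeroPt k) := (runMax_zeroPt k).symm
    _ ≤ runMax x := monotone_runMax hk.le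
    _ ≤ max 0 (runMax x) := le_max_right _ _
    _ = 0 := hmax

section Vertices

variable {m₁ m₂ : ℕ}

theorem planePart_eq_zero_iff {x : EuclideanSpace ℝ (Fin (m₁ + m₂ + 2))}
    (hx : x ∈ oscManifold m₁ m₂) : planePart m₁ m₂ x = (0, 0) ↔ x = 0 := by
  refine ⟨fun h => ?_, fun h => by rw [h, planePart, map_zero]; rfl⟩
  have hy := (snd_snd_fst_coords_eq_zero_iff hx).2 (by rw [h, c₀_zero])
  have hz := (snd_snd_snd_coords_eq_zero_iff hx).2 (by rw [h]; simp [disk])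
  obtain ⟨ht, hr⟩ := Prod.mk.inj h
  exact (coords m₁ m₂).map_eq_zero_iff.1 (Prod.ext ht (Prod.ext hr (Prod.ext hy hz)))

variable (m₁ m₂) in
/-- The origin, as a point of the zero set of `eMap`. -/
noncomputable def origin : oscManifold m₁ m₂ := ⟨0, by
  rw [mem_oscManifold_iff]
  simp [planePart, c₀_zero, disk]⟩

theorem toComb_ne_tip_iff {x : oscManifold m₁ m₂} :
    toComb m₁ m₂ x ≠ isCombSeq_combHeight.tip ↔ x ≠ origin m₁ m₂ :=
  not_congr <| Subtype.ext_iff.trans <| (foldMap_eq_zero_iff (planePart_mem_region x.2)).trans <|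
    (planePart_eq_zero_iff x.2).trans (Subtype.ext_iff (a2 := origin m₁ m₂)).symm

theorem mem_vertexSet_iff (h₁ : 1 < m₁) (h₂ : 1 < m₂) {g : combSet combHeight}
    (hg : g ≠ isCombSeq_combHeight.tip) : (g : ℝ × ℝ) ∈ IsCombSeq.vertexSet combHeight ↔
      ∃ x : oscManifold m₁ m₂, IsCriticalPointOn (oscManifold m₁ m₂) (fun y => y 0) x ∧
        toComb m₁ m₂ x = g := by
  have hg0 : (g : ℝ × ℝ) ≠ (0, 0) := fun h => hg (Subtype.ext h)
  rw [← or_iff_right (b := (g : ℝ × ℝ) ∈ IsCombSeq.vertexSet combHeight) hg0, ← mem_insert_iff,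
    ← image_foldMap_criticalSet]
  constructor
  · rintro ⟨d, hd, hdg⟩
    obtain ⟨x, hx, rfl⟩ := exists_planePart_eq h₁ h₂ hd.1
    exact ⟨⟨x, hx⟩, (isCriticalPointOn_iff hx).2 hd, Subtype.ext hdg⟩
  · rintro ⟨x, hx, rfl⟩
    exact ⟨_, (isCriticalPointOn_iff x.2).1 hx, rfl⟩

theorem mem_image_reebMap_iff (h₁ : 1 < m₁) (h₂ : 1 < m₂) (s : ReebSpace (oscHeight m₁ m₂)) :
    s ∈ reebMap (oscHeight m₁ m₂) '' {x | x ≠ origin m₁ m₂} ↔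
      reebHomeo h₁ h₂ s ≠ isCombSeq_combHeight.tip := by
  constructor
  · rintro ⟨x, hx, rfl⟩
    exact toComb_ne_tip_iff.2 hx
  · obtain ⟨x, rfl⟩ := Quotient.exists_rep s
    exact fun h => ⟨x, toComb_ne_tip_iff.1 h, rfl⟩

/-- The homeomorphism of the Reeb space with the comb, away from the origin and the tip. -/
noncomputable def reebHomeoSubtype (h₁ : 1 < m₁) (h₂ : 1 < m₂) :
    (reebMap (oscHeight m₁ m₂) '' {x | x ≠ origin m₁ m₂}) ≃ₜ
      {g : combSet combHeight // g ≠ isCombSeq_combHeight.tip} :=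
  (reebHomeo h₁ h₂).subtype (mem_image_reebMap_iff h₁ h₂)

theorem image_vertices_comap (h₁ : 1 < m₁) (h₂ : 1 < m₂) : Subtype.val ''
    (isCombSeq_combHeight.eGraph.comap (reebHomeoSubtype h₁ h₂)).vertices =
      {s | ∃ x : oscManifold m₁ m₂, x ≠ origin m₁ m₂ ∧
        IsCriticalPointOn (oscManifold m₁ m₂) (fun y => y 0) x ∧
        reebMap (oscHeight m₁ m₂) x = s} := by
  ext s
  constructor
  · rintro ⟨s, hs, rfl⟩
    have hne := (reebHomeoSubtype h₁ h₂ s).2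
    obtain ⟨x, hx, hxs⟩ := (mem_vertexSet_iff h₁ h₂ hne).1 hs
    exact ⟨x, toComb_ne_tip_iff.1 (hxs ▸ hne), hx, (reebHomeo h₁ h₂).injective hxs⟩
  · rintro ⟨x, hne, hx, rfl⟩
    exact ⟨⟨_, x, hne, rfl⟩,
      (mem_vertexSet_iff h₁ h₂ (toComb_ne_tip_iff.2 hne)).2 ⟨x, hx, rfl⟩, rfl⟩

end Vertices

theorem theorem2 :
    ∃ p₁ p₂ r₁ r₂ r₁₂ : ℝ, 0 < p₁ ∧ 0 < p₂ ∧ 0 < r₁ ∧ 0 < r₂ ∧ 0 < r₁₂ ∧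
    ∃ (G : Type) (_ : TopologicalSpace G), IsPeanoContinuum G ∧
      ¬ HomeomorphicToEGraph.{u} G ∧
      ∃ (p : G) (Γ : EGraph {x : G // x ≠ p}),
        -- the point `p` is the only one with an E-graph as its complement
        (∀ p' : G, HomeomorphicToEGraph.{u} {x : G // x ≠ p'} → p' = p) ∧
        -- `G` is the one-point compactification of the E-graph `G - {p}`
        NoncompactSpace {x : G // x ≠ p} ∧
        (∃ ψ : OnePoint {x : G // x ≠ p} ≃ₜ G,
          ψ OnePoint.infty = p ∧ ∀ x : {x : G // x ≠ p}, ψ (x : OnePoint _) = x) ∧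
        ∀ m₁ m₂ : ℕ, 1 < m₁ → 1 < m₂ →
          ContDiff ℝ ∞ (eMap p₁ p₂ r₁ r₂ r₁₂ m₁ m₂) ∧
          (∃ Z : Set (EuclideanSpace ℝ (Fin (m₁ + m₂ + 2))), volume Z = 0 ∧
            ∀ x ∉ Z, AnalyticAt ℝ (eMap p₁ p₂ r₁ r₂ r₁₂ m₁ m₂) x) ∧
          IsSmoothSubmanifold (m₁ + m₂) (zeroManifold p₁ p₂ r₁ r₂ r₁₂ m₁ m₂) ∧
          IsCompact (zeroManifold p₁ p₂ r₁ r₂ r₁₂ m₁ m₂) ∧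
          IsConnected (zeroManifold p₁ p₂ r₁ r₂ r₁₂ m₁ m₂) ∧
          -- the Reeb space is homeomorphic to `G`
          ∃ h : ReebSpace (cFun p₁ p₂ r₁ r₂ r₁₂ m₁ m₂) ≃ₜ G,
            -- the origin `o` lies on the manifold; the image of its complement under the quotient
            -- map is an E-graph whose vertices represent the critical contours
            ∃ o : zeroManifold p₁ p₂ r₁ r₂ r₁₂ m₁ m₂,
              (o : EuclideanSpace ℝ (Fin (m₁ + m₂ + 2))) = 0 ∧
              ∃ R : EGraph (reebMap (cFun p₁ p₂ r₁ r₂ r₁₂ m₁ m₂) '' {x | x ≠ o}),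
                Subtype.val '' R.vertices = {s | ∃ x : zeroManifold p₁ p₂ r₁ r₂ r₁₂ m₁ m₂, x ≠ o ∧
                  IsCriticalPointOn (zeroManifold p₁ p₂ r₁ r₂ r₁₂ m₁ m₂) (fun y => y 0) x ∧
                  reebMap (cFun p₁ p₂ r₁ r₂ r₁₂ m₁ m₂) x = s} ∧
                -- and `h` restricts to an isomorphism from this E-graph onto `G - {p}`
                ∃ φ : (reebMap (cFun p₁ p₂ r₁ r₂ r₁₂ m₁ m₂) '' {x | x ≠ o}) ≃ₜ {x : G // x ≠ p},
                  (∀ s, (φ s : G) = h s) ∧ R.IsIso Γ φ := by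
  have hH := isCombSeq_combHeight
  refine ⟨1 / (2 * π), 1 / (2 * π), 1, 1, 1 / (2 * π ^ 2), by positivity, by positivity, one_pos,
    one_pos, by positivity, combSet combHeight, inferInstance, hH.isPeanoContinuum_combSet,
    hH.not_homeomorphicToEGraph, hH.tip, hH.eGraph,
    fun _ => hH.eq_tip_of_homeomorphicToEGraph, hH.noncompactSpace,
    hH.exists_onePoint_homeomorph, fun m₁ m₂ h₁ h₂ => ?_⟩
  have hanalytic : ∀ x ∉ {x : EuclideanSpace ℝ (Fin (m₁ + m₂ + 2)) | x 1 = 0},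
      AnalyticAt ℝ (oscMap m₁ m₂) x := fun _ => analyticAt_eMap _ _ _ _ _
  exact ⟨contDiff_eMap .., ⟨_, volume_setOf_apply_eq_zero 1, hanalytic⟩,
    isSmoothSubmanifold_oscManifold m₁ m₂, isCompact_oscManifold h₁ h₂,
    isConnected_oscManifold h₁ h₂, reebHomeo h₁ h₂, origin m₁ m₂, rfl,
    hH.eGraph.comap (reebHomeoSubtype h₁ h₂), image_vertices_comap h₁ h₂,
    reebHomeoSubtype h₁ h₂, fun _ => rfl, EGraph.comap_isIso _ _⟩
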